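/- Let $n\ge1$, $1<p_1,p_2<\infty$, let $p$ be defined by $\frac1p=\frac1{p_1}+\frac1{p_2}$, and suppose $1<p\le q<\infty$; let $q'=\frac{q}{q-1}$. Let $\alpha,\beta,\gamma_1,\gamma_2$ be real numbers with $\alpha<n$ such that $$\beta<\frac nq,\qquad \gamma_1<(p-1)\frac n{p_1},\qquad \gamma_2<(p-1)\frac n{p_2},$$ $$\alpha+\beta+\gamma_1+\gamma_2=n+\frac nq-\frac np,\qquad \beta+\gamma_1+\gamma_2\ge0.$$ Then there is a constant $C<\infty$, depending only on $n,p_1,p_2,q,\alpha,\beta,\gamma_1,\gamma_2$, such that for all measurable functions $f,g,h:\mathbb R^n\to[0,\infty]$, $$\int_{\mathbb R^n}\int_{\mathbb R^n}\frac{f(x-y)\,g(x+y)\,h(x)}{|y|^{\alpha}\,|x-y|^{\gamma_1}\,|x+y|^{\gamma_2}\,|x|^{\beta}}\,dx\,dy\le C\,\|f\|_{L^{p_1}(\mathbb R^n)}\,\|g\|_{L^{p_2}(\mathbb R^n)}\,\|h\|_{L^{q'}(\mathbb R^n)},$$ where $0\cdot\infty=0$ on the right-hand side. -/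

import Mathlib

open MeasureTheory
open scoped ENNReal NNReal

noncomputable section

/-- The trilinear form
`∬ f(x-y) g(x+y) h(x) |y|^(-α) |x-y|^(-γ₁) |x+y|^(-γ₂) |x|^(-β) dx dy` on `ℝⁿ` with its Euclidean
norm and Lebesgue measure, for functions with values in `[0,∞]`. It takes values in `[0,∞]`. -/
def steinWeissForm (n : ℕ) (α β γ₁ γ₂ : ℝ) (f g h : EuclideanSpace ℝ (Fin n) → ℝ≥0∞) : ℝ≥0∞ :=
  ∫⁻ y : EuclideanSpace ℝ (Fin n), ∫⁻ x : EuclideanSpace ℝ (Fin n),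
    f (x - y) * g (x + y) * h x *
      (‖y‖ₑ ^ (-α) * ‖x - y‖ₑ ^ (-γ₁) * ‖x + y‖ₑ ^ (-γ₂) * ‖x‖ₑ ^ (-β))

end

/-! ### Radial power integrals -/

section PowerIntegrals

open Module Set

variable {E : Type*} [NormedAddCommGroup E] [NormedSpace ℝ E] [FiniteDimensional ℝ E]
  [MeasurableSpace E] [BorelSpace E] (μ : Measure E) [μ.IsAddHaarMeasure]

/-! Put θ = 1/p, τ = 1/q', a = p/p₁, b = p/p₂, so that a + b = 1. If the weight is at most a product
k₁(x, x-y)^a k₂(x, x+y)^b, Hölder with exponents 1/a and 1/b separates f from g and leaves two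
bilinear forms on L^p × L^{q'} with kernels k₁ and k₂ (`TrilinBound.of_bilinBound`). It remains to
dominate the weight by a finite sum of such products with bounded kernels.

Three regimes occur. If |y| ≥ 2|x|, then |x±y| ~ |y|, and only |x|^(-β) survives beside a power of
|x±y|: a Hardy kernel, bounded because β < n/q. If |x| ≥ 2|y|, the weight is comparable to
|y|^(-α)|x|^(-s) with s = β+γ₁+γ₂ ≥ 0: a local kernel, bounded by Hardy–Littlewood–Sobolev when p <
q and by Schur's test when p = q. If |x| ~ |y|, then x-y and x+y cannot both be small, since they
add up to 2x. Only one of the weights |x∓y|^(-γᵢ) is then singular, and it is charged entirely to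
its own Hölder factor. This replaces γ₁ by γ₁/a or γ₂ by γ₂/b, and the resulting Hardy condition
γ₁/a < n(1-1/p) is exactly γ₁ < (p-1)n/p₁, and likewise for γ₂.

Hardy kernels are handled by an off-diagonal Schur test (`BilinBound.of_schur`).
Hardy–Littlewood–Sobolev is proved directly, from a pointwise inequality for a^θ b^τ. The linear
relation among the exponents supplies the homogeneity n(2-θ-τ) needed throughout. -/

/-- Scaling of the integral of a radial function. -/
theorem lintegral_radial_eq_mul (F : ℝ≥0∞ → ℝ≥0∞) {R : ℝ≥0∞} (h0 : R ≠ 0) (ht : R ≠ ∞) :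
    ∫⁻ z : E, F ‖z‖ₑ ∂μ = R ^ (finrank ℝ E : ℝ) * ∫⁻ z : E, F (R * ‖z‖ₑ) ∂μ := by
  have hr : 0 < R.toReal := ENNReal.toReal_pos h0 ht
  have key : ∫⁻ z : E, F ‖R.toReal • z‖ₑ ∂μ =
      ENNReal.ofReal |(R.toReal ^ finrank ℝ E)⁻¹| * ∫⁻ z : E, F ‖z‖ₑ ∂μ := by
    -- The dilation is taken as a measurable equivalence because `F` need not be measurable.
    have h := lintegral_map_equiv (μ := μ) (fun z : E => F ‖z‖ₑ)
      (Homeomorph.smul (isUnit_iff_ne_zero.2 hr.ne').unit).toMeasurableEquiv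
    have h' : Measure.map (Homeomorph.smul (isUnit_iff_ne_zero.2 hr.ne').unit).toMeasurableEquiv μ
        = Measure.map (R.toReal • ·) μ := rfl
    rw [h', Measure.map_addHaar_smul μ hr.ne', lintegral_smul_measure] at h
    exact h.symm
  have he : ‖R.toReal‖ₑ = R := by
    rw [Real.enorm_eq_ofReal hr.le, ENNReal.ofReal_toReal ht]
  have hc : ENNReal.ofReal |(R.toReal ^ finrank ℝ E)⁻¹| = (R ^ (finrank ℝ E : ℝ))⁻¹ := by
    rw [abs_of_pos (by positivity), ENNReal.ofReal_inv_of_pos (by positivity),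
      ENNReal.ofReal_pow hr.le, ENNReal.ofReal_toReal ht, ENNReal.rpow_natCast]
  simp only [enorm_smul, he, hc] at key
  rw [key, ← mul_assoc, ENNReal.mul_inv_cancel, one_mul]
  · simp [h0]
  · simp [ht]

/-- Polar coordinates contribute the Jacobian t^(d-1), so finiteness is a one-dimensional question.
-/
theorem lintegral_indicator_rpow_enorm_lt_top [Nontrivial E] {S : Set ℝ} (hS : MeasurableSet S)
    (a : ℝ) (h : IntegrableOn (fun t : ℝ => t ^ (finrank ℝ E - 1 + a)) (S ∩ Ioi 0)) :
    ∫⁻ z : E, S.indicator (fun t => ENNReal.ofReal (t ^ a)) ‖z‖ ∂μ < ∞ := by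
  have hd : 0 < finrank ℝ E := finrank_pos
  have h1 : Integrable (fun z : E => S.indicator (fun t : ℝ => t ^ a) ‖z‖) μ := by
    rw [integrable_fun_norm_addHaar μ (f := S.indicator (fun t : ℝ => t ^ a))]
    have : IntegrableOn (S.indicator (fun t : ℝ => t ^ (finrank ℝ E - 1 + a))) (Ioi 0) := by
      rw [IntegrableOn, integrable_indicator_iff hS, IntegrableOn, Measure.restrict_restrict hS]
      exact h
    refine this.congr_fun (fun t (ht : 0 < t) => ?_) measurableSet_Ioi
    by_cases hts : t ∈ S
    · simp only [hts, indicator_of_mem, smul_eq_mul]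
      rw [Real.rpow_add ht, ← Real.rpow_natCast, Nat.cast_sub hd, Nat.cast_one]
    · simp [hts]
  convert h1.lintegral_lt_top using 3 with z
  by_cases hts : ‖z‖ ∈ S <;> simp [hts]

/-- By homogeneity everything reduces to R = 1, where t^(s-1) is integrable at 0. -/
theorem exists_lintegral_ball_rpow_enorm_le [Nontrivial E] {s : ℝ} (hs : 0 < s) :
    ∃ C : ℝ≥0, C ≠ 0 ∧ ∀ R : ℝ≥0∞,
      ∫⁻ z : E, (Iic R).indicator (fun t => t ^ (s - finrank ℝ E)) ‖z‖ₑ ∂μ ≤ C * R ^ s := by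
  have hfin : ∫⁻ z : E, (Iic 1).indicator (fun t : ℝ≥0∞ => t ^ (s - finrank ℝ E)) ‖z‖ₑ ∂μ < ∞ := by
    have h := lintegral_indicator_rpow_enorm_lt_top μ (measurableSet_Iic (a := (1 : ℝ)))
      (s - finrank ℝ E) ?_
    · refine lt_of_le_of_lt (lintegral_mono_ae ?_) h
      filter_upwards [compl_mem_ae_iff.2 (measure_singleton (μ := μ) (0 : E))] with z hz
      have hz' : 0 < ‖z‖ := norm_pos_iff.2 hz
      have hiff : ‖z‖ₑ ≤ 1 ↔ ‖z‖ ≤ 1 := by rw [← ofReal_norm, ENNReal.ofReal_le_one]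
      by_cases hz1 : ‖z‖ ≤ 1
      · rw [indicator_of_mem (mem_Iic.2 (hiff.2 hz1)), indicator_of_mem (by simpa using hz1),
          ← ENNReal.ofReal_rpow_of_pos hz', ofReal_norm]
      · rw [indicator_of_notMem]
        · simp
        · exact fun h => hz1 (hiff.1 h)
    · rw [inter_comm, Ioi_inter_Iic, integrableOn_Ioc_iff_integrableOn_Ioo,
        intervalIntegral.integrableOn_Ioo_rpow_iff one_pos]
      linarith
  -- The added 1 keeps the constant nonzero, so that the right-hand side really is ∞ at R = ∞.
  refine ⟨(∫⁻ z : E, (Iic 1).indicator (fun t : ℝ≥0∞ => t ^ (s - finrank ℝ E)) ‖z‖ₑ ∂μ).toNNReal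
    + 1, by positivity, fun R => ?_⟩
  rcases eq_or_ne R 0 with rfl | h0
  · refine le_of_eq_of_le ?_ zero_le
    rw [lintegral_eq_zero_iff' (by
      refine AEMeasurable.comp_measurable (g := (Iic (0 : ℝ≥0∞)).indicator _) ?_ measurable_enorm
      exact (Measurable.indicator (by fun_prop) measurableSet_Iic).aemeasurable)]
    filter_upwards [compl_mem_ae_iff.2 (measure_singleton (μ := μ) (0 : E))] with z hz
    have hz' : z ≠ 0 := hz
    simp [hz']
  rcases eq_or_ne R ∞ with rfl | ht
  · simp [hs, ENNReal.mul_top]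
  rw [lintegral_radial_eq_mul μ _ h0 ht]
  have : ∀ z : E, (Iic R).indicator (fun t => t ^ (s - finrank ℝ E)) (R * ‖z‖ₑ) ≤
      R ^ (s - finrank ℝ E) * (Iic 1).indicator (fun t : ℝ≥0∞ => t ^ (s - finrank ℝ E)) ‖z‖ₑ := by
    intro z
    by_cases hz : ‖z‖ₑ ≤ 1
    · rw [indicator_of_mem (s := Iic 1) hz]
      refine (indicator_le_self _ _ _).trans ?_
      rw [ENNReal.mul_rpow_of_ne_top ht (by simp)]
    · rw [indicator_of_notMem]
      · simp
      · simp only [mem_Iic, not_le] at hz ⊢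
        calc R = R * 1 := (mul_one R).symm
          _ < R * ‖z‖ₑ := (ENNReal.mul_lt_mul_iff_right h0 ht).2 hz
  calc _ ≤ R ^ (finrank ℝ E : ℝ) * ∫⁻ z : E, R ^ (s - finrank ℝ E) *
        (Iic 1).indicator (fun t : ℝ≥0∞ => t ^ (s - finrank ℝ E)) ‖z‖ₑ ∂μ := by
        gcongr with z; exact this z
    _ = R ^ s * ∫⁻ z : E, (Iic 1).indicator (fun t : ℝ≥0∞ => t ^ (s - finrank ℝ E)) ‖z‖ₑ ∂μ := by
        rw [lintegral_const_mul' _ _ (ENNReal.rpow_ne_top_of_ne_zero h0 ht), ← mul_assoc,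
          ← ENNReal.rpow_add _ _ h0 ht]
        congr 2; ring
    _ ≤ _ := by
        rw [mul_comm]
        gcongr
        rw [ENNReal.coe_add, ENNReal.coe_toNNReal hfin.ne]
        exact le_self_add

/-- The same scaling argument, now with t^(-s-1) integrable at infinity. -/
theorem exists_lintegral_compl_ball_rpow_enorm_le [Nontrivial E] {s : ℝ} (hs : 0 < s) :
    ∃ C : ℝ≥0, C ≠ 0 ∧ ∀ R : ℝ≥0∞,
      ∫⁻ z : E, (Ici R).indicator (fun t => t ^ (-s - finrank ℝ E)) ‖z‖ₑ ∂μ ≤ C * R ^ (-s) := by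
  have hfin : ∫⁻ z : E, (Ici 1).indicator (fun t : ℝ≥0∞ => t ^ (-s - finrank ℝ E)) ‖z‖ₑ ∂μ
      < ∞ := by
    have h := lintegral_indicator_rpow_enorm_lt_top μ (measurableSet_Ici (a := (1 : ℝ)))
      (-s - finrank ℝ E) ?_
    · refine lt_of_le_of_lt (lintegral_mono_ae ?_) h
      filter_upwards [compl_mem_ae_iff.2 (measure_singleton (μ := μ) (0 : E))] with z hz
      have hz' : 0 < ‖z‖ := norm_pos_iff.2 hz
      have hiff : 1 ≤ ‖z‖ₑ ↔ 1 ≤ ‖z‖ := by rw [← ofReal_norm, ENNReal.one_le_ofReal]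
      by_cases hz1 : 1 ≤ ‖z‖
      · refine (indicator_le_self _ _ _).trans ?_
        rw [indicator_of_mem (by simpa using hz1),
          ← ENNReal.ofReal_rpow_of_pos hz', ofReal_norm]
      · rw [indicator_of_notMem]
        · simp
        · exact fun h => hz1 (hiff.1 h)
    · have : Ici (1 : ℝ) ∩ Ioi 0 = Ici 1 :=
        inter_eq_left.2 fun t (ht : 1 ≤ t) => lt_of_lt_of_le one_pos ht
      rw [this, integrableOn_Ici_iff_integrableOn_Ioi, integrableOn_Ioi_rpow_iff one_pos]
      linarith
  refine ⟨(∫⁻ z : E, (Ici 1).indicator (fun t : ℝ≥0∞ => t ^ (-s - finrank ℝ E)) ‖z‖ₑ ∂μ).toNNReal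
    + 1, by positivity, fun R => ?_⟩
  rcases eq_or_ne R 0 with rfl | h0
  · rw [ENNReal.zero_rpow_of_neg (by linarith), ENNReal.mul_top]
    · exact le_top
    · simp
  rcases eq_or_ne R ∞ with rfl | ht
  · simp
  rw [lintegral_radial_eq_mul μ _ h0 ht]
  have : ∀ z : E, (Ici R).indicator (fun t => t ^ (-s - finrank ℝ E)) (R * ‖z‖ₑ) ≤
      R ^ (-s - finrank ℝ E) *
        (Ici 1).indicator (fun t : ℝ≥0∞ => t ^ (-s - finrank ℝ E)) ‖z‖ₑ := by
    intro z
    by_cases hz : 1 ≤ ‖z‖ₑ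
    · rw [indicator_of_mem (s := Ici 1) hz]
      refine (indicator_le_self _ _ _).trans ?_
      rw [ENNReal.mul_rpow_of_ne_top ht (by simp)]
    · rw [indicator_of_notMem]
      · simp
      · simp only [mem_Ici, not_le] at hz ⊢
        calc R * ‖z‖ₑ < R * 1 := (ENNReal.mul_lt_mul_iff_right h0 ht).2 hz
          _ = R := mul_one R
  calc _ ≤ R ^ (finrank ℝ E : ℝ) * ∫⁻ z : E, R ^ (-s - finrank ℝ E) *
        (Ici 1).indicator (fun t : ℝ≥0∞ => t ^ (-s - finrank ℝ E)) ‖z‖ₑ ∂μ := by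
        gcongr with z; exact this z
    _ = R ^ (-s) *
        ∫⁻ z : E, (Ici 1).indicator (fun t : ℝ≥0∞ => t ^ (-s - finrank ℝ E)) ‖z‖ₑ ∂μ := by
        rw [lintegral_const_mul' _ _ (ENNReal.rpow_ne_top_of_ne_zero h0 ht), ← mul_assoc,
          ← ENNReal.rpow_add _ _ h0 ht]
        congr 2; ring
    _ ≤ _ := by
        rw [mul_comm]
        gcongr
        rw [ENNReal.coe_add, ENNReal.coe_toNNReal hfin.ne]
        exact le_self_add

end PowerIntegrals

/-! ### Bilinear bounds and the Schur test -/

section BilinearBounds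

open Module Set

variable {E : Type*} [MeasurableSpace E]

/-- The kernel `k` defines a bounded bilinear form on `L^(1/θ) × L^(1/τ)`, expressed for the
functions `φ ^ θ` and `ψ ^ τ` with `φ`, `ψ` integrable. -/
def BilinBound (μ : Measure E) (θ τ : ℝ) (k : E → E → ℝ≥0∞) : Prop :=
  ∃ C : ℝ≥0, ∀ φ ψ : E → ℝ≥0∞, Measurable φ → Measurable ψ →
    ∫⁻ x, ∫⁻ u, φ u ^ θ * ψ x ^ τ * k x u ∂μ ∂μ ≤
      C * (∫⁻ u, φ u ∂μ) ^ θ * (∫⁻ x, ψ x ∂μ) ^ τ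

variable {μ : Measure E}

theorem BilinBound.mono {θ τ : ℝ} {k k' : E → E → ℝ≥0∞} (h : BilinBound μ θ τ k') (c : ℝ≥0)
    (hk : ∀ᵐ x ∂μ, ∀ᵐ u ∂μ, k x u ≤ c * k' x u) : BilinBound μ θ τ k := by
  obtain ⟨C, hC⟩ := h
  refine ⟨c * C, fun φ ψ hφ hψ => ?_⟩
  calc ∫⁻ x, ∫⁻ u, φ u ^ θ * ψ x ^ τ * k x u ∂μ ∂μ
      ≤ ∫⁻ x, ∫⁻ u, c * (φ u ^ θ * ψ x ^ τ * k' x u) ∂μ ∂μ := by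
        refine lintegral_mono_ae (hk.mono fun x hx => lintegral_mono_ae (hx.mono fun u hu => ?_))
        calc _ ≤ φ u ^ θ * ψ x ^ τ * (c * k' x u) := by gcongr
          _ = _ := by ring
    _ = c * ∫⁻ x, ∫⁻ u, φ u ^ θ * ψ x ^ τ * k' x u ∂μ ∂μ := by
        simp_rw [lintegral_const_mul' _ _ (ENNReal.coe_ne_top (r := c))]
    _ ≤ _ := by
        grw [hC φ ψ hφ hψ]
        rw [ENNReal.coe_mul]
        exact le_of_eq (by ring)

theorem BilinBound.swap [SFinite μ] {θ τ : ℝ} {k : E → E → ℝ≥0∞} (h : BilinBound μ θ τ k)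
    (hk : Measurable (Function.uncurry k)) : BilinBound μ τ θ (fun x u => k u x) := by
  obtain ⟨C, hC⟩ := h
  refine ⟨C, fun φ ψ hφ hψ => ?_⟩
  rw [lintegral_lintegral_swap]
  · calc _ = ∫⁻ u, ∫⁻ x, ψ x ^ θ * φ u ^ τ * k u x ∂μ ∂μ := by
          simp_rw [mul_comm (φ _ ^ τ)]
      _ ≤ _ := hC ψ φ hψ hφ
      _ = _ := by ring
  · have hk' : Measurable fun z : E × E => k z.2 z.1 := hk.comp measurable_swap
    exact Measurable.aemeasurable (by fun_prop)

theorem lintegral_lintegral_add_left [SFinite μ] {f : E × E → ℝ≥0∞} (hf : Measurable f)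
    (g : E → E → ℝ≥0∞) :
    ∫⁻ x, ∫⁻ u, (f (x, u) + g x u) ∂μ ∂μ =
      (∫⁻ x, ∫⁻ u, f (x, u) ∂μ ∂μ) + ∫⁻ x, ∫⁻ u, g x u ∂μ ∂μ := by
  rw [← lintegral_add_left hf.lintegral_prod_right']
  exact lintegral_congr fun x => lintegral_add_left (hf.comp measurable_prodMk_left) _

theorem lintegral_mul_mul_rpow_le {α : Type*} [MeasurableSpace α] {ν : Measure α}
    {f g h : α → ℝ≥0∞} (hf : AEMeasurable f ν) (hg : AEMeasurable g ν) (hh : AEMeasurable h ν)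
    {a b c : ℝ} (ha : 0 ≤ a) (hb : 0 ≤ b) (hc : 0 ≤ c) (habc : a + b + c = 1) :
    ∫⁻ z, f z ^ a * g z ^ b * h z ^ c ∂ν ≤
      (∫⁻ z, f z ∂ν) ^ a * (∫⁻ z, g z ∂ν) ^ b * (∫⁻ z, h z ∂ν) ^ c := by
  have := ENNReal.lintegral_prod_norm_pow_le (μ := ν) Finset.univ (f := ![f, g, h])
    (p := ![a, b, c]) (by simp [Fin.forall_fin_succ, hf, hg, hh])
    (by simp [Fin.sum_univ_three, habc]) (by simp [Fin.forall_fin_succ, ha, hb, hc])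
  simpa [Fin.prod_univ_three] using this

/-- A Schur test for `L^p → L^q` bounds with `p ≤ q`. -/
theorem BilinBound.of_schur [SFinite μ] {θ τ : ℝ} (hθ : θ ≤ 1) (hτ : τ ≤ 1) (hθτ : 1 ≤ θ + τ)
    {k A B : E → E → ℝ≥0∞} (hA : Measurable (Function.uncurry A))
    (hB : Measurable (Function.uncurry B)) {c CA CB : ℝ≥0}
    (hk : ∀ᵐ x ∂μ, ∀ᵐ u ∂μ, k x u ≤ c * (A x u ^ (1 - τ) * B x u ^ (1 - θ)))
    (hAle : ∀ᵐ u ∂μ, ∫⁻ x, A x u ∂μ ≤ CA) (hBle : ∀ᵐ x ∂μ, ∫⁻ u, B x u ∂μ ≤ CB) :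
    BilinBound μ θ τ k := by
  refine BilinBound.mono (k' := fun x u => A x u ^ (1 - τ) * B x u ^ (1 - θ)) ?_ c hk
  refine ⟨CA ^ (1 - τ) * CB ^ (1 - θ), fun φ ψ hφ hψ => ?_⟩
  have hA' : Measurable fun z : E × E => A z.1 z.2 := hA
  have hB' : Measurable fun z : E × E => B z.1 z.2 := hB
  -- The integrand factors as (φA)^(1-τ) (ψB)^(1-θ) (φψ)^(θ+τ-1). These exponents are nonnegative
  -- with sum 1, so three-function Hölder applies.
  have e1 : ∀ a : ℝ≥0∞, a ^ θ = a ^ (1 - τ) * a ^ (θ + τ - 1) := fun a => by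
    rw [← ENNReal.rpow_add_of_nonneg _ _ (by linarith) (by linarith)]; congr 1; ring
  have e2 : ∀ a : ℝ≥0∞, a ^ τ = a ^ (1 - θ) * a ^ (θ + τ - 1) := fun a => by
    rw [← ENNReal.rpow_add_of_nonneg _ _ (by linarith) (by linarith)]; congr 1; ring
  have i1 : ∫⁻ z, φ z.2 * A z.1 z.2 ∂μ.prod μ ≤ CA * ∫⁻ u, φ u ∂μ := by
    rw [lintegral_prod_symm' _ (by fun_prop), ← lintegral_const_mul _ hφ]
    refine lintegral_mono_ae (hAle.mono fun u hu => ?_)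
    change ∫⁻ x, φ u * A x u ∂μ ≤ _
    rw [lintegral_const_mul _ (by fun_prop), mul_comm]
    gcongr
  have i2 : ∫⁻ z, ψ z.1 * B z.1 z.2 ∂μ.prod μ ≤ CB * ∫⁻ u, ψ u ∂μ := by
    rw [lintegral_prod _ (by fun_prop), ← lintegral_const_mul _ hψ]
    refine lintegral_mono_ae (hBle.mono fun u hu => ?_)
    change ∫⁻ x, ψ u * B u x ∂μ ≤ _
    rw [lintegral_const_mul _ (by fun_prop), mul_comm]
    gcongr
  have i3 : ∫⁻ z, φ z.2 * ψ z.1 ∂μ.prod μ = (∫⁻ u, φ u ∂μ) * ∫⁻ u, ψ u ∂μ := by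
    rw [mul_comm, ← lintegral_prod_mul hψ.aemeasurable hφ.aemeasurable]
    simp_rw [mul_comm]
  calc ∫⁻ x, ∫⁻ u, φ u ^ θ * ψ x ^ τ * (A x u ^ (1 - τ) * B x u ^ (1 - θ)) ∂μ ∂μ
      = ∫⁻ z, (φ z.2 * A z.1 z.2) ^ (1 - τ) * (ψ z.1 * B z.1 z.2) ^ (1 - θ) *
          (φ z.2 * ψ z.1) ^ (θ + τ - 1) ∂μ.prod μ := by
        rw [lintegral_prod _ (by fun_prop)]
        refine lintegral_congr fun x => lintegral_congr fun u => ?_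
        rw [e1, e2, ENNReal.mul_rpow_of_nonneg _ _ (by linarith : 0 ≤ 1 - τ),
          ENNReal.mul_rpow_of_nonneg _ _ (by linarith : 0 ≤ 1 - θ),
          ENNReal.mul_rpow_of_nonneg _ _ (by linarith : 0 ≤ θ + τ - 1)]
        ring
    _ ≤ _ := lintegral_mul_mul_rpow_le (by fun_prop) (by fun_prop) (by fun_prop)
        (by linarith) (by linarith) (by linarith) (by ring)
    _ ≤ (CA * ∫⁻ u, φ u ∂μ) ^ (1 - τ) * (CB * ∫⁻ u, ψ u ∂μ) ^ (1 - θ) *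
          ((∫⁻ u, φ u ∂μ) * ∫⁻ u, ψ u ∂μ) ^ (θ + τ - 1) := by
        have h1 : 0 ≤ 1 - τ := by linarith
        have h2 : 0 ≤ 1 - θ := by linarith
        rw [i3]
        gcongr
    _ = _ := by
        rw [e1, e2, ENNReal.mul_rpow_of_nonneg _ _ (by linarith : 0 ≤ 1 - τ),
          ENNReal.mul_rpow_of_nonneg _ _ (by linarith : 0 ≤ 1 - θ),
          ENNReal.mul_rpow_of_nonneg _ _ (by linarith : 0 ≤ θ + τ - 1), ENNReal.coe_mul,
          ENNReal.coe_rpow_of_nonneg _ (by linarith), ENNReal.coe_rpow_of_nonneg _ (by linarith)]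
        ring

/-- It suffices to prove a bilinear bound for normalised functions. -/
theorem BilinBound.of_normalized {θ τ : ℝ} (hθ : 0 < θ) (hτ : 0 < τ) {k : E → E → ℝ≥0∞} {C : ℝ≥0}
    (h : ∀ φ ψ : E → ℝ≥0∞, Measurable φ → Measurable ψ → ∫⁻ u, φ u ∂μ = 1 → ∫⁻ x, ψ x ∂μ = 1 →
      ∫⁻ x, ∫⁻ u, φ u ^ θ * ψ x ^ τ * k x u ∂μ ∂μ ≤ C) : BilinBound μ θ τ k := by
  -- A nonzero constant makes the right-hand side infinite when one integral is infinite and the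
  -- other nonzero.
  refine ⟨C + 1, fun φ ψ hφ hψ => ?_⟩
  set I := ∫⁻ u, φ u ∂μ with hI
  set J := ∫⁻ x, ψ x ∂μ with hJ
  rcases eq_or_ne I 0 with hI0 | hI0
  · have h0 := (lintegral_eq_zero_iff hφ).1 (hI.symm.trans hI0)
    refine le_of_eq_of_le ?_ zero_le
    have : ∀ x, ∫⁻ u, φ u ^ θ * ψ x ^ τ * k x u ∂μ = 0 := fun x => by
      rw [← lintegral_zero (μ := μ)]
      refine lintegral_congr_ae (h0.mono fun u hu => ?_)
      have hu' : φ u = 0 := hu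
      simp [hu', hθ]
    simp [this]
  rcases eq_or_ne J 0 with hJ0 | hJ0
  · have h0 := (lintegral_eq_zero_iff hψ).1 (hJ.symm.trans hJ0)
    refine le_of_eq_of_le ?_ zero_le
    rw [← lintegral_zero (μ := μ)]
    refine lintegral_congr_ae (h0.mono fun u hu => ?_)
    have hu' : ψ u = 0 := hu
    simp [hu', hτ]
  have hC : ((C + 1 : ℝ≥0) : ℝ≥0∞) ≠ 0 := by positivity
  rcases eq_or_ne I ∞ with hIt | hIt
  · refine le_of_le_of_eq le_top ?_
    rw [hIt, ENNReal.top_rpow_of_pos hθ, ENNReal.mul_top hC, ENNReal.top_mul]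
    simp [hJ0, hτ.le]
  rcases eq_or_ne J ∞ with hJt | hJt
  · refine le_of_le_of_eq le_top ?_
    rw [hJt, ENNReal.top_rpow_of_pos hτ, ENNReal.mul_top]
    simp [hI0, hIt]
  have key := h (fun u => I⁻¹ * φ u) (fun x => J⁻¹ * ψ x) (by fun_prop) (by fun_prop)
    (by rw [lintegral_const_mul _ hφ, ← hI, ENNReal.inv_mul_cancel hI0 hIt])
    (by rw [lintegral_const_mul _ hψ, ← hJ, ENNReal.inv_mul_cancel hJ0 hJt])
  have hIθ : I ^ θ ≠ ∞ := by simp [hIt, hθ.le]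
  have hJτ : J ^ τ ≠ ∞ := by simp [hJt, hτ.le]
  calc ∫⁻ x, ∫⁻ u, φ u ^ θ * ψ x ^ τ * k x u ∂μ ∂μ
      = ∫⁻ x, ∫⁻ u, (I ^ θ * J ^ τ) *
          ((I⁻¹ * φ u) ^ θ * (J⁻¹ * ψ x) ^ τ * k x u) ∂μ ∂μ := by
        refine lintegral_congr fun x => lintegral_congr fun u => ?_
        have h1 : φ u ^ θ = I ^ θ * (I⁻¹ * φ u) ^ θ := by
          rw [← ENNReal.mul_rpow_of_nonneg _ _ hθ.le, ← mul_assoc,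
            ENNReal.mul_inv_cancel hI0 hIt, one_mul]
        have h2 : ψ x ^ τ = J ^ τ * (J⁻¹ * ψ x) ^ τ := by
          rw [← ENNReal.mul_rpow_of_nonneg _ _ hτ.le, ← mul_assoc,
            ENNReal.mul_inv_cancel hJ0 hJt, one_mul]
        rw [h1, h2]; ring
    _ = (I ^ θ * J ^ τ) * ∫⁻ x, ∫⁻ u, (I⁻¹ * φ u) ^ θ * (J⁻¹ * ψ x) ^ τ * k x u ∂μ ∂μ := by
        simp_rw [lintegral_const_mul' _ _ (ENNReal.mul_ne_top hIθ hJτ)]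
    _ ≤ (I ^ θ * J ^ τ) * (C + 1 : ℝ≥0) := by
        gcongr
        exact key.trans (by simp)
    _ = _ := by ring

end BilinearBounds

/-! ### The Hardy–Littlewood–Sobolev inequality -/

section HardyLittlewoodSobolev

open Module Set

variable {E : Type*} [NormedAddCommGroup E] [NormedSpace ℝ E] [FiniteDimensional ℝ E]
  [MeasurableSpace E] [BorelSpace E]

/-- The profile `t ^ (1 + ε)` for `t ≤ 1` and `t ^ (1 - ε)` for `t > 1`. -/
noncomputable def twoPowerProfile (ε : ℝ) (t : ℝ≥0∞) : ℝ≥0∞ := if t ≤ 1 then t ^ (1 + ε) else t ^ (1 - ε)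

theorem measurable_twoPowerProfile (ε : ℝ) : Measurable (twoPowerProfile ε) :=
  Measurable.ite measurableSet_Iic (by fun_prop) (by fun_prop)

/-- If both numbers are at most 1, the larger one to the power θ+τ ≥ 1+ε dominates. If exactly one
exceeds 1, its power is at most the power 1-ε and the other factor is dropped. If both exceed 1, the
product ab dominates. -/
theorem rpow_mul_rpow_le_twoPowerProfile {θ τ ε : ℝ} (hε : 0 ≤ ε) (hθ : 0 ≤ θ) (hτ : 0 ≤ τ) (h1 : ε ≤ 1 - θ)
    (h2 : ε ≤ 1 - τ) (h3 : ε ≤ θ + τ - 1) (a b : ℝ≥0∞) :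
    a ^ θ * b ^ τ ≤ twoPowerProfile ε a + twoPowerProfile ε b + a * b := by
  unfold twoPowerProfile
  split_ifs with ha hb hb
  · rcases le_total a b with hab | hab
    · calc a ^ θ * b ^ τ ≤ b ^ θ * b ^ τ := by gcongr
        _ = b ^ (θ + τ) := (ENNReal.rpow_add_of_nonneg _ _ hθ hτ).symm
        _ ≤ b ^ (1 + ε) := ENNReal.rpow_le_rpow_of_exponent_ge hb (by linarith)
        _ ≤ _ := by rw [add_assoc]; exact le_add_left le_self_add
    · calc a ^ θ * b ^ τ ≤ a ^ θ * a ^ τ := by gcongr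
        _ = a ^ (θ + τ) := (ENNReal.rpow_add_of_nonneg _ _ hθ hτ).symm
        _ ≤ a ^ (1 + ε) := ENNReal.rpow_le_rpow_of_exponent_ge ha (by linarith)
        _ ≤ _ := by rw [add_assoc]; exact le_self_add
  · calc a ^ θ * b ^ τ ≤ 1 * b ^ (1 - ε) := by
          gcongr
          · exact ENNReal.rpow_le_one ha hθ
          · exact (not_le.1 hb).le
          · linarith
      _ ≤ _ := by rw [one_mul, add_assoc]; exact le_add_left le_self_add
  · calc a ^ θ * b ^ τ ≤ a ^ (1 - ε) * 1 := by
          gcongr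
          · exact (not_le.1 ha).le
          · linarith
          · exact ENNReal.rpow_le_one hb hτ
      _ ≤ _ := by rw [mul_one, add_assoc]; exact le_self_add
  · refine le_add_left ?_
    nth_rw 2 [← ENNReal.rpow_one a, ← ENNReal.rpow_one b]
    gcongr
    · exact (not_le.1 ha).le
    · linarith
    · exact (not_le.1 hb).le
    · linarith

/-- The profile changes power at |z| = t^(-1/d). The exponents 1±ε give |z|^(-d±dε), integrable at 0
and at infinity respectively, and scaling makes both pieces linear in t; linearity turns t = φ(u)
into the integral of φ. -/
theorem exists_lintegral_twoPowerProfile_le [Nontrivial E] (μ : Measure E) [μ.IsAddHaarMeasure]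
    {ε : ℝ} (hε : 0 < ε) :
    ∃ C : ℝ≥0, ∀ t : ℝ≥0∞, ∫⁻ z : E, ‖z‖ₑ ^ (-2 * finrank ℝ E : ℝ) *
      twoPowerProfile ε (t * ‖z‖ₑ ^ (finrank ℝ E : ℝ)) ∂μ ≤ C * t := by
  have hd : (0 : ℝ) < finrank ℝ E := by exact_mod_cast finrank_pos
  set d : ℝ := (finrank ℝ E : ℝ)
  obtain ⟨C₁, hC₁, h₁⟩ := exists_lintegral_ball_rpow_enorm_le μ (mul_pos hd hε)
  obtain ⟨C₂, -, h₂⟩ := exists_lintegral_compl_ball_rpow_enorm_le μ (mul_pos hd hε)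
  refine ⟨C₁ + C₂, fun t => ?_⟩
  rcases eq_or_ne t 0 with rfl | ht0
  · simp [twoPowerProfile, ENNReal.zero_rpow_of_pos (by linarith : 0 < 1 + ε)]
  rcases eq_or_ne t ∞ with rfl | ht
  · rw [ENNReal.mul_top]
    · exact le_top
    · simp [hC₁]
  have hR : ∀ z : E, t * ‖z‖ₑ ^ d ≤ 1 ↔ ‖z‖ₑ ≤ t ^ (-1 / d) := fun z => by
    rw [show t ^ (-1 / d) = t⁻¹ ^ d⁻¹ by
        rw [ENNReal.inv_rpow, ← ENNReal.rpow_neg]; congr 1; field_simp,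
      ENNReal.le_rpow_inv_iff hd, ENNReal.le_inv_iff_mul_le, mul_comm]
  calc ∫⁻ z : E, ‖z‖ₑ ^ (-2 * d) * twoPowerProfile ε (t * ‖z‖ₑ ^ d) ∂μ
      ≤ ∫⁻ z : E, (t ^ (1 + ε) * (Iic (t ^ (-1 / d))).indicator (fun s => s ^ (d * ε - d)) ‖z‖ₑ
        + t ^ (1 - ε) * (Ici (t ^ (-1 / d))).indicator (fun s => s ^ (-(d * ε) - d)) ‖z‖ₑ) ∂μ := by
        refine lintegral_mono_ae ?_
        filter_upwards [compl_mem_ae_iff.2 (measure_singleton (μ := μ) (0 : E))] with z hz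
        have hz' : ‖z‖ₑ ≠ 0 := by simpa using hz
        have hzt : ‖z‖ₑ ≠ ∞ := by simp
        unfold twoPowerProfile
        split_ifs with hle
        · refine le_add_right ?_
          rw [indicator_of_mem (mem_Iic.2 ((hR z).1 hle)), ENNReal.mul_rpow_of_ne_top ht (by simp [hd.le]),
            ← ENNReal.rpow_mul, mul_left_comm, ← ENNReal.rpow_add _ _ hz' hzt]
          apply le_of_eq; congr 2; ring
        · refine le_add_left ?_
          rw [indicator_of_mem (mem_Ici.2 (not_le.1 fun h => hle ((hR z).2 h)).le),
            ENNReal.mul_rpow_of_ne_top ht (by simp [hd.le]),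
            ← ENNReal.rpow_mul, mul_left_comm, ← ENNReal.rpow_add _ _ hz' hzt]
          apply le_of_eq; congr 2; ring
    _ ≤ t ^ (1 + ε) * (C₁ * (t ^ (-1 / d)) ^ (d * ε)) +
        t ^ (1 - ε) * (C₂ * (t ^ (-1 / d)) ^ (-(d * ε))) := by
        rw [lintegral_add_left, lintegral_const_mul' _ _ (ENNReal.rpow_ne_top_of_ne_zero ht0 ht),
          lintegral_const_mul' _ _ (ENNReal.rpow_ne_top_of_ne_zero ht0 ht)]
        · gcongr
          · exact h₁ _
          · exact h₂ _
        · refine Measurable.const_mul (Measurable.comp (g := (Iic _).indicator _) ?_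
            measurable_enorm) _
          exact Measurable.indicator (by fun_prop) measurableSet_Iic
    _ = _ := by
        rw [← ENNReal.rpow_mul, ← ENNReal.rpow_mul, mul_left_comm, mul_left_comm (t ^ (1 - ε)),
          ← ENNReal.rpow_add _ _ ht0 ht, ← ENNReal.rpow_add _ _ ht0 ht,
          show 1 + ε + -1 / d * (d * ε) = 1 by field_simp; ring,
          show 1 - ε + -1 / d * -(d * ε) = 1 by field_simp; ring, ENNReal.rpow_one, ← add_mul,
          ENNReal.coe_add]

/-- The Hardy–Littlewood–Sobolev inequality. -/
theorem bilinBound_enorm_sub_rpow [Nontrivial E] (μ : Measure E) [μ.IsAddHaarMeasure] {θ τ : ℝ}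
    (hθ : 0 < θ) (hθ' : θ < 1) (hτ : 0 < τ) (hτ' : τ < 1) (hθτ : 1 < θ + τ) :
    BilinBound μ θ τ (fun x u => ‖x - u‖ₑ ^ (-(finrank ℝ E * (2 - θ - τ)))) := by
  obtain ⟨ε, hε, h1, h2, h3⟩ : ∃ ε : ℝ, 0 < ε ∧ ε ≤ 1 - θ ∧ ε ≤ 1 - τ ∧ ε ≤ θ + τ - 1 :=
    ⟨min (1 - θ) (min (1 - τ) (θ + τ - 1)), lt_min (by linarith) (lt_min (by linarith) (by linarith)),
      min_le_left _ _, (min_le_right _ _).trans (min_le_left _ _),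
      (min_le_right _ _).trans (min_le_right _ _)⟩
  obtain ⟨C, hC⟩ := exists_lintegral_twoPowerProfile_le μ hε
  have hd : (0 : ℝ) < finrank ℝ E := by exact_mod_cast finrank_pos
  set d : ℝ := (finrank ℝ E : ℝ)
  have hG := measurable_twoPowerProfile ε
  refine BilinBound.of_normalized hθ hτ (C := C + C + 1) fun φ ψ hφ hψ hφ1 hψ1 => ?_
  have m1 : Measurable fun z : E × E =>
      ‖z.1 - z.2‖ₑ ^ (-2 * d) * twoPowerProfile ε (φ z.2 * ‖z.1 - z.2‖ₑ ^ d) := by fun_prop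
  have m2 : Measurable fun z : E × E =>
      ‖z.1 - z.2‖ₑ ^ (-2 * d) * twoPowerProfile ε (ψ z.1 * ‖z.1 - z.2‖ₑ ^ d) := by fun_prop
  calc ∫⁻ x, ∫⁻ u, φ u ^ θ * ψ x ^ τ * ‖x - u‖ₑ ^ (-(d * (2 - θ - τ))) ∂μ ∂μ
      ≤ ∫⁻ x, ∫⁻ u, (‖x - u‖ₑ ^ (-2 * d) * twoPowerProfile ε (φ u * ‖x - u‖ₑ ^ d) +
          ‖x - u‖ₑ ^ (-2 * d) * twoPowerProfile ε (ψ x * ‖x - u‖ₑ ^ d) + ψ x * φ u) ∂μ ∂μ := by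
        refine lintegral_mono fun x => lintegral_mono_ae ?_
        filter_upwards [compl_mem_ae_iff.2 (measure_singleton (μ := μ) x)] with u hu
        have hr : ‖x - u‖ₑ ≠ 0 := by
          simpa [sub_eq_zero, eq_comm] using hu
        have hrt : ‖x - u‖ₑ ≠ ∞ := by simp
        have hrt' := ENNReal.rpow_ne_top_of_ne_zero (y := d) hr hrt
        generalize ‖x - u‖ₑ = r at *
        have key := rpow_mul_rpow_le_twoPowerProfile hε.le hθ.le hτ.le h1 h2 h3 (φ u * r ^ d)
          (ψ x * r ^ d)
        -- Absorbing r^d into each function leaves the weight r^(-2d), which exactly cancels in the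
        -- product term.
        have e1 : φ u ^ θ * ψ x ^ τ * r ^ (-(d * (2 - θ - τ))) =
            r ^ (-2 * d) * ((φ u * r ^ d) ^ θ * (ψ x * r ^ d) ^ τ) := by
          rw [ENNReal.mul_rpow_of_nonneg _ _ hθ.le, ENNReal.mul_rpow_of_nonneg _ _ hτ.le,
            ← ENNReal.rpow_mul, ← ENNReal.rpow_mul,
            show -(d * (2 - θ - τ)) = -2 * d + d * θ + d * τ by ring,
            ENNReal.rpow_add _ _ hr hrt, ENNReal.rpow_add _ _ hr hrt]
          ring
        have e2 : r ^ (-2 * d) * (φ u * r ^ d * (ψ x * r ^ d)) = ψ x * φ u := by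
          have : r ^ (-2 * d) * (r ^ d * r ^ d) = 1 := by
            rw [← ENNReal.rpow_add _ _ hr hrt, ← ENNReal.rpow_add _ _ hr hrt,
              show -2 * d + (d + d) = 0 by ring, ENNReal.rpow_zero]
          calc _ = (r ^ (-2 * d) * (r ^ d * r ^ d)) * (ψ x * φ u) := by ring
            _ = _ := by rw [this, one_mul]
        rw [e1, ← e2, ← mul_add, ← mul_add]
        gcongr
    _ = (∫⁻ x, ∫⁻ u, ‖x - u‖ₑ ^ (-2 * d) * twoPowerProfile ε (φ u * ‖x - u‖ₑ ^ d) ∂μ ∂μ) +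
        (∫⁻ x, ∫⁻ u, ‖x - u‖ₑ ^ (-2 * d) * twoPowerProfile ε (ψ x * ‖x - u‖ₑ ^ d) ∂μ ∂μ) +
        ∫⁻ x, ∫⁻ u, ψ x * φ u ∂μ ∂μ := by
        rw [← lintegral_lintegral_add_left m1]
        exact lintegral_lintegral_add_left (m1.add m2) _
    _ ≤ C * (∫⁻ u, φ u ∂μ) + C * (∫⁻ x, ψ x ∂μ) + (∫⁻ x, ψ x ∂μ) * (∫⁻ u, φ u ∂μ) := by
        gcongr
        · rw [lintegral_lintegral_swap m1.aemeasurable, ← lintegral_const_mul _ hφ]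
          refine lintegral_mono fun u => ?_
          rw [lintegral_sub_right_eq_self
            (fun z => ‖z‖ₑ ^ (-2 * d) * twoPowerProfile ε (φ u * ‖z‖ₑ ^ d))]
          exact hC _
        · rw [← lintegral_const_mul _ hψ]
          refine lintegral_mono fun x => ?_
          rw [lintegral_sub_left_eq_self
            (fun z => ‖z‖ₑ ^ (-2 * d) * twoPowerProfile ε (ψ x * ‖z‖ₑ ^ d))]
          exact hC _
        · simp_rw [lintegral_const_mul _ hφ, lintegral_mul_const _ hψ]
          exact le_rfl
    _ = _ := by rw [hφ1, hψ1]; simp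

end HardyLittlewoodSobolev

/-! ### Hardy kernels and local kernels -/

section Kernels

open Module Set

variable {E : Type*} [NormedAddCommGroup E]

theorem enorm_le_coe_mul_enorm_iff {c : ℝ≥0} {v w : E} : ‖v‖ₑ ≤ c * ‖w‖ₑ ↔ ‖v‖ ≤ c * ‖w‖ := by
  rw [enorm_eq_nnnorm, enorm_eq_nnnorm]
  norm_cast

theorem enn_rpow_le_rpow_of_nonpos {a b : ℝ≥0∞} {t : ℝ} (ht : t ≤ 0) (h : a ≤ b) :
    b ^ t ≤ a ^ t := by
  have := ENNReal.inv_le_inv.2 (ENNReal.rpow_le_rpow h (neg_nonneg.2 ht))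
  rwa [← ENNReal.rpow_neg, ← ENNReal.rpow_neg, neg_neg] at this

theorem enorm_rpow_le_of_norm_le {c : ℝ≥0} (hc : c ≠ 0) {v w : E} (h1 : ‖v‖ ≤ c * ‖w‖)
    (h2 : ‖w‖ ≤ c * ‖v‖) (t : ℝ) : ‖v‖ₑ ^ t ≤ (c ^ |t| : ℝ≥0) * ‖w‖ₑ ^ t := by
  rw [← enorm_le_coe_mul_enorm_iff] at h1 h2
  have hc' : (c : ℝ≥0∞) ≠ 0 := by exact_mod_cast hc
  rw [ENNReal.coe_rpow_of_ne_zero hc]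
  rcases le_or_gt 0 t with ht | ht
  · rw [abs_of_nonneg ht, ← ENNReal.mul_rpow_of_nonneg _ _ ht]
    gcongr
  · have h := enn_rpow_le_rpow_of_nonpos ht.le h2
    rw [ENNReal.mul_rpow_of_ne_top (by simp) (by simp)] at h
    calc ‖v‖ₑ ^ t = (c : ℝ≥0∞) ^ |t| * ((c : ℝ≥0∞) ^ t * ‖v‖ₑ ^ t) := by
          rw [← mul_assoc, ← ENNReal.rpow_add _ _ hc' (by simp), abs_of_neg ht]
          simp
      _ ≤ _ := by gcongr

/-- The kernel `|x| ^ (-β) |u| ^ (-σ)` restricted to `|x| ≤ M |u|`. -/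
noncomputable def hardyKernel (M : ℝ≥0) (β σ : ℝ) (x u : E) : ℝ≥0∞ :=
  if ‖x‖ₑ ≤ M * ‖u‖ₑ then ‖x‖ₑ ^ (-β) * ‖u‖ₑ ^ (-σ) else 0

/-- The kernel `|x - u| ^ (-α) |x| ^ (-s)` restricted to `2 |x - u| ≤ |x|`. -/
noncomputable def localKernel (α s : ℝ) (x u : E) : ℝ≥0∞ :=
  if 2 * ‖x - u‖ₑ ≤ ‖x‖ₑ then ‖x - u‖ₑ ^ (-α) * ‖x‖ₑ ^ (-s) else 0

theorem norm_le_of_localKernel_support {x u : E} (h : 2 * ‖x - u‖ₑ ≤ ‖x‖ₑ) :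
    2 * ‖x - u‖ ≤ ‖x‖ := by
  have h' : 2 * ‖x - u‖₊ ≤ ‖x‖₊ := by
    rw [enorm_eq_nnnorm, enorm_eq_nnnorm] at h
    exact_mod_cast h
  exact_mod_cast h'

variable [NormedSpace ℝ E] [FiniteDimensional ℝ E] [MeasurableSpace E] [BorelSpace E]

theorem measurable_hardyKernel (M : ℝ≥0) (β σ : ℝ) :
    Measurable (Function.uncurry (hardyKernel (E := E) M β σ)) :=
  Measurable.ite (measurableSet_le (by fun_prop) (by fun_prop)) (by fun_prop) (by fun_prop)

theorem measurable_localKernel (α s : ℝ) :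
    Measurable (Function.uncurry (localKernel (E := E) α s)) :=
  Measurable.ite (measurableSet_le (by fun_prop) (by fun_prop)) (by fun_prop) (by fun_prop)

variable [Nontrivial E] (μ : Measure E) [μ.IsAddHaarMeasure]

theorem ae_ne_of_isAddHaar (v : E) : ∀ᵐ x ∂μ, x ≠ v :=
  compl_mem_ae_iff.2 (measure_singleton v)

/-- Schur's test with two auxiliary Hardy kernels of degree -d: |x|^(-t)|u|^(t-d), integrated over
small x, and |x|^s|u|^(-s-d), integrated over large u. -/
theorem bilinBound_hardyKernel {M : ℝ≥0} (hM : M ≠ 0) {θ τ β σ : ℝ} (hθ : θ < 1) (hτ : τ < 1)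
    (hθτ : 1 ≤ θ + τ) (hβ : β < finrank ℝ E * (1 - τ))
    (hβσ : β + σ = finrank ℝ E * (2 - θ - τ)) :
    BilinBound μ θ τ (hardyKernel M β σ) := by
  set d : ℝ := (finrank ℝ E : ℝ)
  have hM' : (M : ℝ≥0∞) ≠ 0 := by exact_mod_cast hM
  obtain ⟨s, t, hs, ht, hx, hu⟩ : ∃ s t : ℝ, 0 < s ∧ t < d ∧ -t * (1 - τ) + s * (1 - θ) = -β ∧
      (t - d) * (1 - τ) + (-s - d) * (1 - θ) = -σ := by
    have h1 : 0 < 1 - θ := by linarith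
    have h2 : 0 < 1 - τ := by linarith
    have e1 : (d * (1 - τ) - β) / 2 / (1 - θ) * (1 - θ) = (d * (1 - τ) - β) / 2 :=
      div_mul_cancel₀ _ h1.ne'
    have e2 : (β + (d * (1 - τ) - β) / 2) / (1 - τ) * (1 - τ) = β + (d * (1 - τ) - β) / 2 :=
      div_mul_cancel₀ _ h2.ne'
    -- Half of the gap d(1-τ)-β pays for s > 0; the other half keeps t < d.
    refine ⟨(d * (1 - τ) - β) / 2 / (1 - θ), (β + (d * (1 - τ) - β) / 2) / (1 - τ), ?_, ?_, ?_, ?_⟩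
    · exact div_pos (by linarith) h1
    · rw [div_lt_iff₀ h2]; linarith
    · linarith
    · linarith
  obtain ⟨C₁, -, hC₁⟩ := exists_lintegral_ball_rpow_enorm_le μ (sub_pos.2 ht)
  obtain ⟨C₂, -, hC₂⟩ := exists_lintegral_compl_ball_rpow_enorm_le μ hs
  refine BilinBound.of_schur hθ.le hτ.le hθτ (A := hardyKernel M t (d - t))
    (B := hardyKernel M (-s) (s + d)) (measurable_hardyKernel _ _ _) (measurable_hardyKernel _ _ _)
    (c := 1) (CA := C₁ * M ^ (d - t)) (CB := C₂ * M ^ s) ?_ ?_ ?_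
  · filter_upwards [ae_ne_of_isAddHaar μ 0] with x hx0
    filter_upwards [ae_ne_of_isAddHaar μ 0] with u hu0
    unfold hardyKernel
    split_ifs
    · have hx1 : ‖x‖ₑ ≠ 0 := by simpa using hx0
      have hu1 : ‖u‖ₑ ≠ 0 := by simpa using hu0
      rw [ENNReal.mul_rpow_of_nonneg _ _ (by linarith : 0 ≤ 1 - τ),
        ENNReal.mul_rpow_of_nonneg _ _ (by linarith : 0 ≤ 1 - θ), ← ENNReal.rpow_mul,
        ← ENNReal.rpow_mul, ← ENNReal.rpow_mul, ← ENNReal.rpow_mul, mul_mul_mul_comm,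
        ← ENNReal.rpow_add _ _ hx1 (by simp), ← ENNReal.rpow_add _ _ hu1 (by simp),
        ENNReal.coe_one, one_mul, ← hx, ← hu]
      apply le_of_eq
      congr 2 <;> ring
    · simp
  · filter_upwards [ae_ne_of_isAddHaar μ 0] with u hu0
    have hu1 : ‖u‖ₑ ≠ 0 := by simpa using hu0
    calc ∫⁻ x, hardyKernel M t (d - t) x u ∂μ
        = ∫⁻ x, ‖u‖ₑ ^ (-(d - t)) * (Iic (M * ‖u‖ₑ)).indicator (fun r => r ^ (d - t - d)) ‖x‖ₑ ∂μ :=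
          lintegral_congr fun x => by
            simp only [hardyKernel, indicator_apply, mem_Iic]
            split_ifs
            · rw [mul_comm]; congr 2; ring
            · simp
      _ ≤ ‖u‖ₑ ^ (-(d - t)) * (C₁ * (M * ‖u‖ₑ) ^ (d - t)) := by
          rw [lintegral_const_mul' _ _ (ENNReal.rpow_ne_top_of_ne_zero hu1 (by simp))]
          gcongr
          exact hC₁ _
      _ = C₁ * M ^ (d - t) * (‖u‖ₑ ^ (-(d - t)) * ‖u‖ₑ ^ (d - t)) := by
          rw [ENNReal.mul_rpow_of_nonneg _ _ (by linarith)]; ring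
      _ = _ := by
          rw [← ENNReal.rpow_add _ _ hu1 (by simp), neg_add_cancel, ENNReal.rpow_zero, mul_one,
            ENNReal.coe_mul, ENNReal.coe_rpow_of_ne_zero hM]
  · filter_upwards [ae_ne_of_isAddHaar μ 0] with x hx0
    have hx1 : ‖x‖ₑ ≠ 0 := by simpa using hx0
    calc ∫⁻ u, hardyKernel M (-s) (s + d) x u ∂μ
        = ∫⁻ u, ‖x‖ₑ ^ s * (Ici ((M : ℝ≥0∞)⁻¹ * ‖x‖ₑ)).indicator (fun r => r ^ (-s - d)) ‖u‖ₑ ∂μ :=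
          lintegral_congr fun u => by
            simp only [hardyKernel, indicator_apply, mem_Ici]
            simp only [ENNReal.inv_mul_le_iff hM' ENNReal.coe_ne_top]
            split_ifs
            · congr 2 <;> ring
            · simp
      _ ≤ ‖x‖ₑ ^ s * (C₂ * ((M : ℝ≥0∞)⁻¹ * ‖x‖ₑ) ^ (-s)) := by
          rw [lintegral_const_mul' _ _ (ENNReal.rpow_ne_top_of_ne_zero hx1 (by simp))]
          gcongr
          exact hC₂ _
      _ = C₂ * M ^ s * (‖x‖ₑ ^ s * ‖x‖ₑ ^ (-s)) := by
          rw [ENNReal.mul_rpow_of_ne_top (by simpa using hM) (by simp), ENNReal.inv_rpow,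
            ENNReal.rpow_neg, inv_inv]; ring
      _ = _ := by
          rw [← ENNReal.rpow_add _ _ hx1 (by simp), add_neg_cancel, ENNReal.rpow_zero, mul_one,
            ENNReal.coe_mul, ENNReal.coe_rpow_of_ne_zero hM]

theorem bilinBound_hardyKernel_swap {M : ℝ≥0} (hM : M ≠ 0) {θ τ γ σ : ℝ} (hθ : θ < 1) (hτ : τ < 1)
    (hθτ : 1 ≤ θ + τ) (hγ : γ < finrank ℝ E * (1 - θ))
    (hγσ : γ + σ = finrank ℝ E * (2 - θ - τ)) :
    BilinBound μ θ τ (fun x u => hardyKernel M γ σ u x) :=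
  (bilinBound_hardyKernel μ hM hτ hθ (by linarith) hγ (by rw [hγσ]; ring)).swap
    (measurable_hardyKernel _ _ _)

/-- For θ+τ > 1, the support condition and s ≥ 0 give |x|^(-s) ≤ |x-u|^(-s), and
Hardy–Littlewood–Sobolev applies. At the endpoint θ+τ = 1 one has s = d-α > 0, and the kernel itself
has bounded marginals because |x| ~ |u| on its support. -/
theorem bilinBound_localKernel {θ τ α s : ℝ} (hθ : 0 < θ) (hθ' : θ < 1) (hτ : 0 < τ) (hτ' : τ < 1)
    (hθτ : 1 ≤ θ + τ) (hα : α < finrank ℝ E) (hs : 0 ≤ s)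
    (hαs : α + s = finrank ℝ E * (2 - θ - τ)) :
    BilinBound μ θ τ (localKernel α s) := by
  rcases hθτ.lt_or_eq with hlt | heq
  · refine (bilinBound_enorm_sub_rpow μ hθ hθ' hτ hτ' hlt).mono 1 ?_
    refine Filter.Eventually.of_forall fun x => ?_
    filter_upwards [ae_ne_of_isAddHaar μ x] with u hu
    unfold localKernel
    split_ifs with h
    · have hr : ‖x - u‖ₑ ≠ 0 := by simpa [sub_eq_zero] using hu.symm
      rw [← hαs, ENNReal.coe_one, one_mul, neg_add, ENNReal.rpow_add _ _ hr (by simp)]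
      gcongr ‖x - u‖ₑ ^ (-α) * ?_
      exact enn_rpow_le_rpow_of_nonpos (by linarith)
        (le_trans (le_mul_of_one_le_left' one_le_two) h)
    · simp
  · set d : ℝ := (finrank ℝ E : ℝ)
    have hsd : s = d - α := by
      have : 2 - θ - τ = 1 := by linarith
      rw [this] at hαs; linarith
    have hs0 : 0 < s := by linarith
    obtain ⟨C, -, hC⟩ := exists_lintegral_ball_rpow_enorm_le μ hs0
    have key : ∀ v : E, v ≠ 0 → ‖v‖ₑ ^ (-s) *
        ∫⁻ z, (Iic ‖v‖ₑ).indicator (fun r => r ^ (s - d)) ‖z‖ₑ ∂μ ≤ C := fun v hv => by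
      have hv1 : ‖v‖ₑ ≠ 0 := by simpa using hv
      calc _ ≤ ‖v‖ₑ ^ (-s) * (C * ‖v‖ₑ ^ s) := by gcongr; exact hC _
        _ = C := by
          rw [mul_left_comm, ← ENNReal.rpow_add _ _ hv1 (by simp), neg_add_cancel,
            ENNReal.rpow_zero, mul_one]
    refine BilinBound.of_schur hθ'.le hτ'.le hθτ (A := localKernel α s) (B := localKernel α s)
      (measurable_localKernel _ _) (measurable_localKernel _ _) (c := 1)
      (CA := 2 ^ |-s| * C) (CB := C) ?_ ?_ ?_
    · refine Filter.Eventually.of_forall fun x => Filter.Eventually.of_forall fun u => ?_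
      rw [← ENNReal.rpow_add_of_nonneg _ _ (by linarith) (by linarith),
        show 1 - τ + (1 - θ) = 1 by linarith]
      simp
    · filter_upwards [ae_ne_of_isAddHaar μ 0] with u hu
      have hu1 : ‖u‖ₑ ≠ 0 := by simpa using hu
      calc ∫⁻ x, localKernel α s x u ∂μ
          ≤ ∫⁻ x, ((2 ^ |-s| : ℝ≥0) * ‖u‖ₑ ^ (-s)) *
            (Iic ‖u‖ₑ).indicator (fun r => r ^ (s - d)) ‖x - u‖ₑ ∂μ := by
            refine lintegral_mono fun x => ?_
            unfold localKernel
            split_ifs with h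
            · have h' := norm_le_of_localKernel_support h
              have t1 := norm_le_norm_add_norm_sub' x u
              have t2 := norm_le_norm_add_norm_sub x u
              have h0 := norm_nonneg (x - u)
              have hmem : ‖x - u‖ₑ ∈ Iic ‖u‖ₑ := by
                have := (enorm_le_coe_mul_enorm_iff (c := 1) (v := x - u) (w := u)).2
                  (by simp; linarith)
                simpa using this
              rw [indicator_of_mem hmem, mul_comm, show s - d = -α by linarith]
              gcongr
              exact enorm_rpow_le_of_norm_le two_ne_zero (by push_cast; linarith)
                (by push_cast; linarith) _
            · simp
        _ = (2 ^ |-s| : ℝ≥0) * (‖u‖ₑ ^ (-s) *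
            ∫⁻ z, (Iic ‖u‖ₑ).indicator (fun r => r ^ (s - d)) ‖z‖ₑ ∂μ) := by
            rw [lintegral_const_mul' _ _ (ENNReal.mul_ne_top (by simp)
              (ENNReal.rpow_ne_top_of_ne_zero hu1 (by simp))), lintegral_sub_right_eq_self
              (fun z => (Iic ‖u‖ₑ).indicator (fun r => r ^ (s - d)) ‖z‖ₑ), mul_assoc]
        _ ≤ _ := by
            rw [ENNReal.coe_mul]
            gcongr
            exact key u hu
    · filter_upwards [ae_ne_of_isAddHaar μ 0] with x hx
      have hx1 : ‖x‖ₑ ≠ 0 := by simpa using hx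
      calc ∫⁻ u, localKernel α s x u ∂μ
          ≤ ∫⁻ u, ‖x‖ₑ ^ (-s) *
            (Iic ‖x‖ₑ).indicator (fun r => r ^ (s - d)) ‖x - u‖ₑ ∂μ := by
            refine lintegral_mono fun u => ?_
            unfold localKernel
            split_ifs with h
            · have hmem : ‖x - u‖ₑ ∈ Iic ‖x‖ₑ := le_trans (le_mul_of_one_le_left' one_le_two) h
              rw [indicator_of_mem hmem, mul_comm, show s - d = -α by linarith]
            · simp
        _ = ‖x‖ₑ ^ (-s) *
            ∫⁻ z, (Iic ‖x‖ₑ).indicator (fun r => r ^ (s - d)) ‖z‖ₑ ∂μ := by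
            rw [lintegral_const_mul' _ _ (ENNReal.rpow_ne_top_of_ne_zero hx1 (by simp)),
              lintegral_sub_left_eq_self
              (fun z => (Iic ‖x‖ₑ).indicator (fun r => r ^ (s - d)) ‖z‖ₑ)]
        _ ≤ _ := key x hx

end Kernels

/-! ### From trilinear to bilinear bounds -/

section Trilinear

open Module Set

/-- The kernel `K x y` defines a bounded trilinear form
`∬ f (x - y) g (x + y) h x K x y` on `L^(1/θ₁) × L^(1/θ₂) × L^(1/τ)`, expressed for
`f = φ₁ ^ θ₁`, `g = φ₂ ^ θ₂` and `h = ψ ^ τ`. -/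
def TrilinBound {E : Type*} [AddGroup E] [MeasurableSpace E] (μ : Measure E) (θ₁ θ₂ τ : ℝ)
    (K : E → E → ℝ≥0∞) : Prop :=
  ∃ C : ℝ≥0, ∀ φ₁ φ₂ ψ : E → ℝ≥0∞, Measurable φ₁ → Measurable φ₂ → Measurable ψ →
    ∫⁻ y, ∫⁻ x, φ₁ (x - y) ^ θ₁ * φ₂ (x + y) ^ θ₂ * ψ x ^ τ * K x y ∂μ ∂μ ≤
      C * (∫⁻ u, φ₁ u ∂μ) ^ θ₁ * (∫⁻ u, φ₂ u ∂μ) ^ θ₂ * (∫⁻ x, ψ x ∂μ) ^ τ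

theorem TrilinBound.mono {E : Type*} [AddGroup E] [MeasurableSpace E] {μ : Measure E}
    {θ₁ θ₂ τ : ℝ} {K K' : E → E → ℝ≥0∞} (h : TrilinBound μ θ₁ θ₂ τ K')
    (c : ℝ≥0) (hK : ∀ᵐ y ∂μ, ∀ᵐ x ∂μ, K x y ≤ c * K' x y) : TrilinBound μ θ₁ θ₂ τ K := by
  obtain ⟨C, hC⟩ := h
  refine ⟨c * C, fun φ₁ φ₂ ψ h₁ h₂ hψ => ?_⟩
  calc _ ≤ ∫⁻ y, ∫⁻ x, c * (φ₁ (x - y) ^ θ₁ * φ₂ (x + y) ^ θ₂ * ψ x ^ τ * K' x y) ∂μ ∂μ := by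
        refine lintegral_mono_ae (hK.mono fun y hy => lintegral_mono_ae (hy.mono fun x hx => ?_))
        grw [hx]
        exact le_of_eq (by ring)
    _ = c * ∫⁻ y, ∫⁻ x, φ₁ (x - y) ^ θ₁ * φ₂ (x + y) ^ θ₂ * ψ x ^ τ * K' x y ∂μ ∂μ := by
        simp_rw [lintegral_const_mul' _ _ (ENNReal.coe_ne_top (r := c))]
    _ ≤ _ := by
        grw [hC φ₁ φ₂ ψ h₁ h₂ hψ]
        rw [ENNReal.coe_mul]
        exact le_of_eq (by ring)

variable {E : Type*} [NormedAddCommGroup E] [NormedSpace ℝ E] [FiniteDimensional ℝ E]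
  [MeasurableSpace E] [BorelSpace E] {μ : Measure E}

theorem TrilinBound.add [SFinite μ] {θ₁ θ₂ τ : ℝ} {K K' : E → E → ℝ≥0∞}
    (h : TrilinBound μ θ₁ θ₂ τ K) (h' : TrilinBound μ θ₁ θ₂ τ K')
    (hK : Measurable (Function.uncurry K)) :
    TrilinBound μ θ₁ θ₂ τ (fun x y => K x y + K' x y) := by
  obtain ⟨C, hC⟩ := h
  obtain ⟨C', hC'⟩ := h'
  have hK' : Measurable fun z : E × E => K z.2 z.1 := hK.comp measurable_swap
  refine ⟨C + C', fun φ₁ φ₂ ψ h₁ h₂ hψ => ?_⟩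
  simp_rw [mul_add]
  have := lintegral_lintegral_add_left (μ := μ) (f := fun z : E × E => φ₁ (z.2 - z.1) ^ θ₁ *
    φ₂ (z.2 + z.1) ^ θ₂ * ψ z.2 ^ τ * K z.2 z.1) (by fun_prop) (fun y x => φ₁ (x - y) ^ θ₁ *
    φ₂ (x + y) ^ θ₂ * ψ x ^ τ * K' x y)
  rw [this, ENNReal.coe_add, add_mul, add_mul, add_mul]
  exact add_le_add (hC φ₁ φ₂ ψ h₁ h₂ hψ) (hC' φ₁ φ₂ ψ h₁ h₂ hψ)

/-- Hölder's inequality reduces a trilinear bound to two bilinear ones. -/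
theorem TrilinBound.of_bilinBound [μ.IsAddHaarMeasure] {θ τ a b : ℝ} (ha : 0 ≤ a) (hb : 0 ≤ b)
    (hab : a + b = 1) {k₁ k₂ : E → E → ℝ≥0∞} (h₁ : BilinBound μ θ τ k₁) (h₂ : BilinBound μ θ τ k₂)
    (hk₁ : Measurable (Function.uncurry k₁)) (hk₂ : Measurable (Function.uncurry k₂)) :
    TrilinBound μ (θ * a) (θ * b) τ (fun x y => k₁ x (x - y) ^ a * k₂ x (x + y) ^ b) := by
  obtain ⟨C₁, hC₁⟩ := h₁
  obtain ⟨C₂, hC₂⟩ := h₂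
  refine ⟨C₁ ^ a * C₂ ^ b, fun φ₁ φ₂ ψ hφ₁ hφ₂ hψ => ?_⟩
  have m₁ : Measurable fun z : E × E => φ₁ (z.1 - z.2) ^ θ * ψ z.1 ^ τ * k₁ z.1 (z.1 - z.2) := by
    have : Measurable fun z : E × E => k₁ z.1 (z.1 - z.2) :=
      hk₁.comp (measurable_fst.prodMk (measurable_fst.sub measurable_snd))
    fun_prop
  have m₂ : Measurable fun z : E × E => φ₂ (z.1 + z.2) ^ θ * ψ z.1 ^ τ * k₂ z.1 (z.1 + z.2) := by
    have : Measurable fun z : E × E => k₂ z.1 (z.1 + z.2) :=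
      hk₂.comp (measurable_fst.prodMk (measurable_fst.add measurable_snd))
    fun_prop
  have i₁ : ∫⁻ z, φ₁ (z.1 - z.2) ^ θ * ψ z.1 ^ τ * k₁ z.1 (z.1 - z.2) ∂μ.prod μ ≤
      C₁ * (∫⁻ u, φ₁ u ∂μ) ^ θ * (∫⁻ x, ψ x ∂μ) ^ τ := by
    rw [lintegral_prod _ m₁.aemeasurable]
    refine le_of_eq_of_le (lintegral_congr fun x => ?_) (hC₁ φ₁ ψ hφ₁ hψ)
    exact lintegral_sub_left_eq_self (fun u => φ₁ u ^ θ * ψ x ^ τ * k₁ x u) x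
  have i₂ : ∫⁻ z, φ₂ (z.1 + z.2) ^ θ * ψ z.1 ^ τ * k₂ z.1 (z.1 + z.2) ∂μ.prod μ ≤
      C₂ * (∫⁻ u, φ₂ u ∂μ) ^ θ * (∫⁻ x, ψ x ∂μ) ^ τ := by
    rw [lintegral_prod _ m₂.aemeasurable]
    refine le_of_eq_of_le (lintegral_congr fun x => ?_) (hC₂ φ₂ ψ hφ₂ hψ)
    exact lintegral_add_left_eq_self (fun u => φ₂ u ^ θ * ψ x ^ τ * k₂ x u) x
  -- The third function is shared by both Hölder factors, in proportions a and b.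
  have split : ∀ t : ℝ≥0∞, t ^ τ = (t ^ τ) ^ a * (t ^ τ) ^ b := fun t => by
    rw [← ENNReal.rpow_add_of_nonneg _ _ ha hb, hab, ENNReal.rpow_one]
  calc ∫⁻ y, ∫⁻ x, φ₁ (x - y) ^ (θ * a) * φ₂ (x + y) ^ (θ * b) * ψ x ^ τ *
        (k₁ x (x - y) ^ a * k₂ x (x + y) ^ b) ∂μ ∂μ
      = ∫⁻ y, ∫⁻ x, (φ₁ (x - y) ^ θ * ψ x ^ τ * k₁ x (x - y)) ^ a *
          (φ₂ (x + y) ^ θ * ψ x ^ τ * k₂ x (x + y)) ^ b ∂μ ∂μ := by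
        refine lintegral_congr fun y => lintegral_congr fun x => ?_
        conv_lhs => rw [split (ψ x)]
        simp only [ENNReal.mul_rpow_of_nonneg _ _ ha, ENNReal.mul_rpow_of_nonneg _ _ hb,
          ENNReal.rpow_mul]
        ring
    _ = ∫⁻ z, (φ₁ (z.1 - z.2) ^ θ * ψ z.1 ^ τ * k₁ z.1 (z.1 - z.2)) ^ a *
          (φ₂ (z.1 + z.2) ^ θ * ψ z.1 ^ τ * k₂ z.1 (z.1 + z.2)) ^ b ∂μ.prod μ :=
        (lintegral_prod_symm' _ ((m₁.pow_const a).mul (m₂.pow_const b))).symm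
    _ ≤ _ := ENNReal.lintegral_mul_norm_pow_le m₁.aemeasurable m₂.aemeasurable ha hb hab
    _ ≤ (C₁ * (∫⁻ u, φ₁ u ∂μ) ^ θ * (∫⁻ x, ψ x ∂μ) ^ τ) ^ a *
          (C₂ * (∫⁻ u, φ₂ u ∂μ) ^ θ * (∫⁻ x, ψ x ∂μ) ^ τ) ^ b := by gcongr
    _ = _ := by
        conv_rhs => rw [split (∫⁻ x, ψ x ∂μ)]
        rw [ENNReal.coe_mul, ENNReal.coe_rpow_of_nonneg _ ha,
          ENNReal.coe_rpow_of_nonneg _ hb]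
        simp only [ENNReal.mul_rpow_of_nonneg _ _ ha, ENNReal.mul_rpow_of_nonneg _ _ hb,
          ENNReal.rpow_mul]
        ring

end Trilinear

/-! ### Pointwise domination of the weight, region by region -/

section SteinWeissKernel

variable {E : Type*} [NormedAddCommGroup E]

/-- The kernel of the weighted trilinear form. -/
noncomputable def steinWeissKernel (α β γ₁ γ₂ : ℝ) (x y : E) : ℝ≥0∞ :=
  ‖y‖ₑ ^ (-α) * ‖x - y‖ₑ ^ (-γ₁) * ‖x + y‖ₑ ^ (-γ₂) * ‖x‖ₑ ^ (-β)

variable {α β γ₁ γ₂ a b : ℝ}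

theorem rpow_eq_mul_of_add_eq_one (hab : a + b = 1) {t : ℝ≥0∞} (h0 : t ≠ 0) (ht : t ≠ ∞) (r : ℝ) :
    t ^ r = t ^ (r * a) * t ^ (r * b) := by
  rw [← ENNReal.rpow_add _ _ h0 ht, ← mul_add, hab, mul_one]

/-- Here |x±y| ~ |y|, so all weights but |x|^(-β) merge into |y|^(-σ), which is redistributed as
|x-y|^(-σa)|x+y|^(-σb). -/
theorem exists_steinWeissKernel_le_hardyKernel (ha : 0 ≤ a) (hb : 0 ≤ b) (hab : a + b = 1) :
    ∃ c : ℝ≥0, ∀ x y : E, x ≠ 0 → y ≠ 0 → 2 * ‖x‖ ≤ ‖y‖ → steinWeissKernel α β γ₁ γ₂ x y ≤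
      c * (hardyKernel 3 β (α + γ₁ + γ₂) x (x - y) ^ a *
        hardyKernel 3 β (α + γ₁ + γ₂) x (x + y) ^ b) := by
  set σ := α + γ₁ + γ₂
  refine ⟨2 ^ |-γ₁| * 2 ^ |-γ₂| * 2 ^ |-σ * a| * 2 ^ |-σ * b|, fun x y hx hy hxy => ?_⟩
  have hx1 : ‖x‖ₑ ≠ 0 := by simpa using hx
  have hy1 : ‖y‖ₑ ≠ 0 := by simpa using hy
  have t1 := norm_sub_le x y
  have t2 := norm_add_le x y
  have t3 := norm_sub_le (x - y) x
  have t4 := norm_sub_le (x + y) x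
  rw [sub_sub_cancel_left, norm_neg] at t3
  rw [add_sub_cancel_left] at t4
  have h0 := norm_nonneg x
  have hu : ‖x‖ₑ ≤ (3 : ℝ≥0) * ‖x - y‖ₑ :=
    enorm_le_coe_mul_enorm_iff.2 (by push_cast; linarith)
  have hv : ‖x‖ₑ ≤ (3 : ℝ≥0) * ‖x + y‖ₑ :=
    enorm_le_coe_mul_enorm_iff.2 (by push_cast; linarith)
  have e1 := enorm_rpow_le_of_norm_le (c := 2) two_ne_zero (v := x - y) (w := y)
    (by push_cast; linarith) (by push_cast; linarith) (-γ₁)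
  have e2 := enorm_rpow_le_of_norm_le (c := 2) two_ne_zero (v := x + y) (w := y)
    (by push_cast; linarith) (by push_cast; linarith) (-γ₂)
  have e3 := enorm_rpow_le_of_norm_le (c := 2) two_ne_zero (v := y) (w := x - y)
    (by push_cast; linarith) (by push_cast; linarith) (-σ * a)
  have e4 := enorm_rpow_le_of_norm_le (c := 2) two_ne_zero (v := y) (w := x + y)
    (by push_cast; linarith) (by push_cast; linarith) (-σ * b)
  rw [hardyKernel, hardyKernel, if_pos hu, if_pos hv, ENNReal.mul_rpow_of_nonneg _ _ ha,
    ENNReal.mul_rpow_of_nonneg _ _ hb, ← ENNReal.rpow_mul, ← ENNReal.rpow_mul, ← ENNReal.rpow_mul,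
    ← ENNReal.rpow_mul, steinWeissKernel]
  simp only [ENNReal.coe_mul]
  generalize ((2 ^ |-γ₁| : ℝ≥0) : ℝ≥0∞) = c₁ at *
  generalize ((2 ^ |-γ₂| : ℝ≥0) : ℝ≥0∞) = c₂ at *
  generalize ((2 ^ |-σ * a| : ℝ≥0) : ℝ≥0∞) = c₃ at *
  generalize ((2 ^ |-σ * b| : ℝ≥0) : ℝ≥0∞) = c₄ at *
  calc _ ≤ ‖y‖ₑ ^ (-α) * (c₁ * ‖y‖ₑ ^ (-γ₁)) * (c₂ * ‖y‖ₑ ^ (-γ₂)) * ‖x‖ₑ ^ (-β) := by gcongr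
    _ = c₁ * c₂ * (‖y‖ₑ ^ (-σ * a) * ‖y‖ₑ ^ (-σ * b)) * ‖x‖ₑ ^ (-β) := by
        rw [← rpow_eq_mul_of_add_eq_one hab hy1 (by simp), show -σ = -α + -γ₁ + -γ₂ by ring,
          ENNReal.rpow_add _ _ hy1 (by simp), ENNReal.rpow_add _ _ hy1 (by simp)]
        ring
    _ ≤ c₁ * c₂ * ((c₃ * ‖x - y‖ₑ ^ (-σ * a)) * (c₄ * ‖x + y‖ₑ ^ (-σ * b))) * ‖x‖ₑ ^ (-β) := by
        gcongr
    _ = _ := by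
        rw [rpow_eq_mul_of_add_eq_one hab hx1 (by simp)]
        ring

/-- Here |x±y| ~ |x|. Since x-(x∓y) = ±y, both local kernels have the same value |y|^(-α)|x|^(-s),
and a + b = 1 recombines them. -/
theorem exists_steinWeissKernel_le_localKernel (ha : 0 ≤ a) (hb : 0 ≤ b) (hab : a + b = 1) :
    ∃ c : ℝ≥0, ∀ x y : E, x ≠ 0 → y ≠ 0 → 2 * ‖y‖ ≤ ‖x‖ → steinWeissKernel α β γ₁ γ₂ x y ≤
      c * (localKernel α (β + γ₁ + γ₂) x (x - y) ^ a *
        localKernel α (β + γ₁ + γ₂) x (x + y) ^ b) := by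
  set s := β + γ₁ + γ₂
  refine ⟨2 ^ |-γ₁| * 2 ^ |-γ₂|, fun x y hx hy hxy => ?_⟩
  have hx1 : ‖x‖ₑ ≠ 0 := by simpa using hx
  have hy1 : ‖y‖ₑ ≠ 0 := by simpa using hy
  have t1 := norm_sub_le x y
  have t2 := norm_add_le x y
  have t3 := norm_add_le (x - y) y
  have t4 := norm_sub_le (x + y) y
  rw [sub_add_cancel] at t3
  rw [add_sub_cancel_right] at t4
  have h0 := norm_nonneg y
  have hxy' : 2 * ‖y‖ₑ ≤ ‖x‖ₑ := by
    rw [enorm_eq_nnnorm, enorm_eq_nnnorm]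
    have : 2 * ‖y‖₊ ≤ ‖x‖₊ := by exact_mod_cast hxy
    exact_mod_cast this
  have hu : 2 * ‖x - (x - y)‖ₑ ≤ ‖x‖ₑ := by rwa [sub_sub_cancel]
  have hv : 2 * ‖x - (x + y)‖ₑ ≤ ‖x‖ₑ := by rwa [sub_add_cancel_left, enorm_neg]
  have e1 := enorm_rpow_le_of_norm_le (c := 2) two_ne_zero (v := x - y) (w := x)
    (by push_cast; linarith) (by push_cast; linarith) (-γ₁)
  have e2 := enorm_rpow_le_of_norm_le (c := 2) two_ne_zero (v := x + y) (w := x)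
    (by push_cast; linarith) (by push_cast; linarith) (-γ₂)
  rw [localKernel, localKernel, if_pos hu, if_pos hv, sub_sub_cancel, sub_add_cancel_left,
    enorm_neg, ← ENNReal.rpow_add_of_nonneg _ _ ha hb, hab, ENNReal.rpow_one, steinWeissKernel]
  simp only [ENNReal.coe_mul]
  generalize ((2 ^ |-γ₁| : ℝ≥0) : ℝ≥0∞) = c₁ at *
  generalize ((2 ^ |-γ₂| : ℝ≥0) : ℝ≥0∞) = c₂ at *
  calc _ ≤ ‖y‖ₑ ^ (-α) * (c₁ * ‖x‖ₑ ^ (-γ₁)) * (c₂ * ‖x‖ₑ ^ (-γ₂)) * ‖x‖ₑ ^ (-β) := by gcongr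
    _ = _ := by
        rw [show -s = -β + -γ₁ + -γ₂ by ring,
          ENNReal.rpow_add _ _ hx1 (by simp), ENNReal.rpow_add _ _ hx1 (by simp)]
        ring

/-- Only x+y can be small here. Its weight goes wholly into the factor raised to the power b, hence
the exponent γ₂/b; the first factor carries no power of |x-y|. The cutoff 3 comes from |x±y| ≤
|x|+|y| ≤ 3|x|. -/
theorem exists_steinWeissKernel_le_hardyKernel_swap (ha : 0 ≤ a) (hb : 0 < b) (hab : a + b = 1) :
    ∃ c : ℝ≥0, ∀ x y : E, x ≠ 0 → ‖x‖ ≤ 2 * ‖y‖ → ‖y‖ ≤ 2 * ‖x‖ → ‖x‖ ≤ ‖x - y‖ →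
      steinWeissKernel α β γ₁ γ₂ x y ≤
        c * (hardyKernel 3 0 (α + β + γ₁ + γ₂) (x - y) x ^ a *
          hardyKernel 3 (γ₂ / b) (α + β + γ₁ + γ₂ - γ₂ / b) (x + y) x ^ b) := by
  set l := α + β + γ₁ + γ₂
  refine ⟨2 ^ |-α| * 3 ^ |-γ₁|, fun x y hx hxy hyx hxu => ?_⟩
  have hx1 : ‖x‖ₑ ≠ 0 := by simpa using hx
  have t1 := norm_sub_le x y
  have t2 := norm_add_le x y
  have h0 := norm_nonneg x
  have hu : ‖x - y‖ₑ ≤ (3 : ℝ≥0) * ‖x‖ₑ :=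
    enorm_le_coe_mul_enorm_iff.2 (by push_cast; linarith)
  have hv : ‖x + y‖ₑ ≤ (3 : ℝ≥0) * ‖x‖ₑ :=
    enorm_le_coe_mul_enorm_iff.2 (by push_cast; linarith)
  have e1 := enorm_rpow_le_of_norm_le (c := 2) two_ne_zero (v := y) (w := x)
    (by push_cast; linarith) (by push_cast; linarith) (-α)
  have e2 := enorm_rpow_le_of_norm_le (c := 3) three_ne_zero (v := x - y) (w := x)
    (by push_cast; linarith) (by push_cast; linarith) (-γ₁)
  rw [hardyKernel, hardyKernel, if_pos hu, if_pos hv, ENNReal.mul_rpow_of_nonneg _ _ ha,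
    ENNReal.mul_rpow_of_nonneg _ _ hb.le, ← ENNReal.rpow_mul, ← ENNReal.rpow_mul,
    ← ENNReal.rpow_mul, ← ENNReal.rpow_mul, steinWeissKernel, neg_zero, zero_mul,
    ENNReal.rpow_zero, one_mul, show -(γ₂ / b) * b = -γ₂ by field_simp]
  simp only [ENNReal.coe_mul]
  generalize ((2 ^ |-α| : ℝ≥0) : ℝ≥0∞) = c₁ at *
  generalize ((3 ^ |-γ₁| : ℝ≥0) : ℝ≥0∞) = c₂ at *
  have e3 : -l * a + -(l - γ₂ / b) * b = -α + -γ₁ + -β := by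
    rw [show -l * a + -(l - γ₂ / b) * b = -l * (a + b) + γ₂ / b * b by ring, hab,
      div_mul_cancel₀ _ hb.ne']
    ring
  calc _ ≤ (c₁ * ‖x‖ₑ ^ (-α)) * (c₂ * ‖x‖ₑ ^ (-γ₁)) * ‖x + y‖ₑ ^ (-γ₂) * ‖x‖ₑ ^ (-β) := by gcongr
    _ = c₁ * c₂ * (‖x‖ₑ ^ (-l * a + -(l - γ₂ / b) * b) * ‖x + y‖ₑ ^ (-γ₂)) := by
        rw [e3, ENNReal.rpow_add _ _ hx1 (by simp), ENNReal.rpow_add _ _ hx1 (by simp)]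
        ring
    _ = _ := by
        rw [ENNReal.rpow_add _ _ hx1 (by simp)]
        ring

end SteinWeissKernel

/-! ### Assembly of the trilinear bound -/

section SteinWeiss

open Module

variable {E : Type*} [NormedAddCommGroup E] [NormedSpace ℝ E] [FiniteDimensional ℝ E]
  [MeasurableSpace E] [BorelSpace E] [Nontrivial E] (μ : Measure E) [μ.IsAddHaarMeasure]

theorem trilinBound_steinWeissKernel {θ τ a b α β γ₁ γ₂ : ℝ} (hθ : 0 < θ) (hθ' : θ < 1)
    (hτ : 0 < τ) (hτ' : τ < 1) (hθτ : 1 ≤ θ + τ) (ha : 0 < a) (hb : 0 < b) (hab : a + b = 1)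
    (hα : α < finrank ℝ E) (hβ : β < finrank ℝ E * (1 - τ))
    (hγ₁ : γ₁ / a < finrank ℝ E * (1 - θ)) (hγ₂ : γ₂ / b < finrank ℝ E * (1 - θ))
    (hsum : α + β + γ₁ + γ₂ = finrank ℝ E * (2 - θ - τ)) (hnonneg : 0 ≤ β + γ₁ + γ₂) :
    TrilinBound μ (θ * a) (θ * b) τ (steinWeissKernel α β γ₁ γ₂) := by
  have hd : (0 : ℝ) < finrank ℝ E := by exact_mod_cast finrank_pos
  have h3 : (3 : ℝ≥0) ≠ 0 := three_ne_zero
  have hba : b + a = 1 := by rw [add_comm, hab]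
  have hzero : (0 : ℝ) < finrank ℝ E * (1 - θ) := mul_pos hd (by linarith)
  have B₁ := bilinBound_hardyKernel μ h3 hθ' hτ' hθτ hβ (σ := α + γ₁ + γ₂) (by linarith)
  have B₂ := bilinBound_localKernel μ (s := β + γ₁ + γ₂) hθ hθ' hτ hτ' hθτ hα hnonneg (by linarith)
  have B₃ := bilinBound_hardyKernel_swap μ h3 hθ' hτ' hθτ hzero (σ := α + β + γ₁ + γ₂)
    (by linarith)
  have B₄ := bilinBound_hardyKernel_swap μ h3 hθ' hτ' hθτ hγ₂ (σ := α + β + γ₁ + γ₂ - γ₂ / b)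
    (by linarith)
  have B₅ := bilinBound_hardyKernel_swap μ h3 hθ' hτ' hθτ hγ₁ (σ := α + β + γ₁ + γ₂ - γ₁ / a)
    (by linarith)
  have mh : ∀ M β σ, Measurable (Function.uncurry (hardyKernel (E := E) M β σ)) :=
    measurable_hardyKernel
  have ms : ∀ M β σ, Measurable (Function.uncurry fun x u : E => hardyKernel M β σ u x) :=
    fun M β σ => (mh M β σ).comp measurable_swap
  have ml : ∀ α s, Measurable (Function.uncurry (localKernel (E := E) α s)) :=
    measurable_localKernel
  have mK : ∀ {k₁ k₂ : E → E → ℝ≥0∞}, Measurable (Function.uncurry k₁) →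
      Measurable (Function.uncurry k₂) →
      Measurable (Function.uncurry fun x y => k₁ x (x - y) ^ a * k₂ x (x + y) ^ b) :=
    fun h₁ h₂ =>
      ((h₁.comp (measurable_fst.prodMk (measurable_fst.sub measurable_snd))).pow_const a).mul
        ((h₂.comp (measurable_fst.prodMk (measurable_fst.add measurable_snd))).pow_const b)
  have T₁ := TrilinBound.of_bilinBound ha.le hb.le hab B₁ B₁ (mh _ _ _) (mh _ _ _)
  have T₂ := TrilinBound.of_bilinBound ha.le hb.le hab B₂ B₂ (ml _ _) (ml _ _)
  have T₃ := TrilinBound.of_bilinBound ha.le hb.le hab B₃ B₄ (ms _ _ _) (ms _ _ _)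
  have T₄ := TrilinBound.of_bilinBound ha.le hb.le hab B₅ B₃ (ms _ _ _) (ms _ _ _)
  obtain ⟨c₁, hc₁⟩ := exists_steinWeissKernel_le_hardyKernel (E := E) (α := α) (β := β)
    (γ₁ := γ₁) (γ₂ := γ₂) ha.le hb.le hab
  obtain ⟨c₂, hc₂⟩ := exists_steinWeissKernel_le_localKernel (E := E) (α := α) (β := β)
    (γ₁ := γ₁) (γ₂ := γ₂) ha.le hb.le hab
  obtain ⟨c₃, hc₃⟩ := exists_steinWeissKernel_le_hardyKernel_swap (E := E) (α := α) (β := β)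
    (γ₁ := γ₁) (γ₂ := γ₂) ha.le hb hab
  obtain ⟨c₄, hc₄⟩ := exists_steinWeissKernel_le_hardyKernel_swap (E := E) (α := α) (β := β)
    (γ₁ := γ₂) (γ₂ := γ₁) hb.le ha hba
  -- Each point lies in a region where one summand already dominates the weight, so the regions need
  -- not be cut out of the integral.
  refine (T₁.add (T₂.add (T₃.add T₄ (mK (ms _ _ _) (ms _ _ _))) (mK (ml _ _) (ml _ _)))
    (mK (mh _ _ _) (mh _ _ _))).mono (c₁ + c₂ + c₃ + c₄) ?_
  filter_upwards [ae_ne_of_isAddHaar μ 0] with y hy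
  filter_upwards [ae_ne_of_isAddHaar μ 0] with x hx
  push_cast
  rcases le_or_gt (2 * ‖x‖) ‖y‖ with h₁ | h₁
  · refine (hc₁ x y hx hy h₁).trans (mul_le_mul' ?_ le_self_add)
    rw [add_assoc, add_assoc]; exact le_self_add
  rcases le_or_gt (2 * ‖y‖) ‖x‖ with h₂ | h₂
  · refine (hc₂ x y hx hy h₂).trans (mul_le_mul' ?_ (le_add_left le_self_add))
    rw [add_assoc, add_assoc, ← add_assoc (c₂ : ℝ≥0∞), add_assoc (c₂ : ℝ≥0∞)]
    exact le_add_left le_self_add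
  rcases le_or_gt ‖x‖ ‖x - y‖ with h₃ | h₃
  · refine (hc₃ x y hx h₂.le h₁.le h₃).trans (mul_le_mul' ?_
      (le_add_left (le_add_left le_self_add)))
    rw [add_assoc]
    exact le_add_left le_self_add
  -- As (x-y)+(x+y) = 2x, smallness of x-y forces |x+y| ≥ |x|. The reflection y ↦ -y then exchanges
  -- γ₁ with γ₂ and a with b.
  · have h₄ : ‖x‖ ≤ ‖x - -y‖ := by
      have h := norm_add_le (x - y) (x + y)
      rw [sub_add_add_cancel, ← two_smul ℝ, norm_smul, Real.norm_two] at h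
      rw [sub_neg_eq_add]
      linarith
    have key := hc₄ x (-y) hx (by rw [norm_neg]; exact h₂.le) (by rw [norm_neg]; exact h₁.le) h₄
    rw [sub_neg_eq_add, ← sub_eq_add_neg] at key
    calc steinWeissKernel α β γ₁ γ₂ x y = steinWeissKernel α β γ₂ γ₁ x (-y) := by
          rw [steinWeissKernel, steinWeissKernel, sub_neg_eq_add, ← sub_eq_add_neg, enorm_neg]
          ring
      _ ≤ _ := key
      _ ≤ _ := by
          rw [mul_comm (hardyKernel _ _ _ _ _ ^ b),
            show α + β + γ₂ + γ₁ = α + β + γ₁ + γ₂ by ring]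
          exact mul_le_mul' (le_add_left le_rfl) (le_add_left (le_add_left (le_add_left le_rfl)))

end SteinWeiss

/-! ### Translation to Lebesgue norms on Euclidean space -/

theorem eLpNorm_ofReal_eq_lintegral_rpow {α : Type*} [MeasurableSpace α] {μ : Measure α} {p : ℝ}
    (hp : 0 < p) (f : α → ℝ≥0∞) :
    eLpNorm f (ENNReal.ofReal p) μ = (∫⁻ x, f x ^ p ∂μ) ^ (1 / p) := by
  rw [eLpNorm_eq_lintegral_rpow_enorm_toReal (by simpa using hp) ENNReal.ofReal_ne_top,
    ENNReal.toReal_ofReal hp.le]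
  simp

/-- For each fixed y, translation by ±y preserves null sets. This permits passing to measurable
representatives. -/
theorem steinWeissForm_congr_ae {n : ℕ} {α β γ₁ γ₂ : ℝ}
    {f f' g g' h h' : EuclideanSpace ℝ (Fin n) → ℝ≥0∞} (hf : f =ᵐ[volume] f')
    (hg : g =ᵐ[volume] g') (hh : h =ᵐ[volume] h') :
    steinWeissForm n α β γ₁ γ₂ f g h = steinWeissForm n α β γ₁ γ₂ f' g' h' := by
  refine lintegral_congr fun y => lintegral_congr_ae ?_
  filter_upwards [hh, (measurePreserving_sub_right volume y).quasiMeasurePreserving.ae hf,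
    (measurePreserving_add_right volume y).quasiMeasurePreserving.ae hg] with x h1 h2 h3
  rw [h1, h2, h3]

theorem mainTheorem12 (n : ℕ) (p₁ p₂ p q α β γ₁ γ₂ : ℝ)
    (hp₁ : 1 < p₁) (hp₂ : 1 < p₂) (hp : 1 / p = 1 / p₁ + 1 / p₂)
    (hp_one : 1 < p) (hpq : p ≤ q)
    (hα : α < n)
    (hβ : β < n / q)
    (hγ₁ : γ₁ < (p - 1) * (n / p₁))
    (hγ₂ : γ₂ < (p - 1) * (n / p₂))
    (hsum : α + β + γ₁ + γ₂ = n + n / q - n / p)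
    (hnonneg : 0 ≤ β + γ₁ + γ₂) :
    ∃ C : ℝ≥0, ∀ f g h : EuclideanSpace ℝ (Fin n) → ℝ≥0∞,
      AEMeasurable f volume → AEMeasurable g volume → AEMeasurable h volume →
      steinWeissForm n α β γ₁ γ₂ f g h ≤
        C * eLpNorm f (ENNReal.ofReal p₁) volume * eLpNorm g (ENNReal.ofReal p₂) volume *
          eLpNorm h (ENNReal.ofReal (Real.conjExponent q)) volume := by
  -- In dimension 0 the exponents β, γ₁, γ₂ would all be negative, against `hnonneg`.
  have hn : n ≠ 0 := by
    rintro rfl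
    simp only [Nat.cast_zero, zero_div, mul_zero] at hβ hγ₁ hγ₂
    linarith
  have : Nonempty (Fin n) := ⟨⟨0, Nat.pos_of_ne_zero hn⟩⟩
  have hp0 : 0 < p := by linarith
  have hq0 : 0 < q := by linarith
  have hp₁0 : 0 < p₁ := by linarith
  have hp₂0 : 0 < p₂ := by linarith
  have hq1 : 0 < q - 1 := by linarith
  have hθ' : 1 / p < 1 := by rw [div_lt_one hp0]; exact hp_one
  have hqlt : 1 / q < 1 := by rw [div_lt_one hq0]; linarith
  have hqp : 1 / q ≤ 1 / p := one_div_le_one_div_of_le hp0 hpq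
  have hqpos : 0 < 1 / q := by positivity
  have hconj : 0 < Real.conjExponent q := div_pos hq0 hq1
  have hτ : 1 / Real.conjExponent q = 1 - 1 / q := by
    rw [Real.conjExponent]; field_simp
  have hab : p / p₁ + p / p₂ = 1 := by
    rw [div_eq_mul_one_div p p₁, div_eq_mul_one_div p p₂, ← mul_add, ← hp,
      mul_one_div_cancel hp0.ne']
  have e₁ : 1 / p * (p / p₁) = 1 / p₁ := by field_simp
  have e₂ : 1 / p * (p / p₂) = 1 / p₂ := by field_simp
  have hT := trilinBound_steinWeissKernel (volume : Measure (EuclideanSpace ℝ (Fin n)))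
    (θ := 1 / p) (τ := 1 - 1 / q) (a := p / p₁) (b := p / p₂) (α := α) (β := β) (γ₁ := γ₁)
    (γ₂ := γ₂) (by positivity) hθ' (by linarith) (by linarith) (by linarith) (by positivity)
    (by positivity) hab (by simpa using hα)
    (by rw [finrank_euclideanSpace_fin]; convert hβ using 1; ring)
    (by
      rw [finrank_euclideanSpace_fin, div_lt_iff₀ (by positivity)]
      rwa [show (n : ℝ) * (1 - 1 / p) * (p / p₁) = (p - 1) * (n / p₁) by field_simp])
    (by
      rw [finrank_euclideanSpace_fin, div_lt_iff₀ (by positivity)]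
      rwa [show (n : ℝ) * (1 - 1 / p) * (p / p₂) = (p - 1) * (n / p₂) by field_simp])
    (by rw [hsum, finrank_euclideanSpace_fin]; ring) hnonneg
  rw [e₁, e₂, ← hτ] at hT
  obtain ⟨C, hC⟩ := hT
  refine ⟨C, fun f g h hf hg hh => ?_⟩
  rw [steinWeissForm_congr_ae hf.ae_eq_mk hg.ae_eq_mk hh.ae_eq_mk,
    eLpNorm_congr_ae hf.ae_eq_mk, eLpNorm_congr_ae hg.ae_eq_mk, eLpNorm_congr_ae hh.ae_eq_mk,
    eLpNorm_ofReal_eq_lintegral_rpow hp₁0, eLpNorm_ofReal_eq_lintegral_rpow hp₂0,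
    eLpNorm_ofReal_eq_lintegral_rpow hconj]
  have cancel : ∀ {r : ℝ}, 0 < r → ∀ t : ℝ≥0∞, (t ^ r) ^ (1 / r) = t := fun hr t => by
    rw [← ENNReal.rpow_mul, mul_one_div_cancel hr.ne', ENNReal.rpow_one]
  -- The trilinear bound is stated for powers of integrable functions, so it is applied to f^p₁,
  -- g^p₂ and h^q'.
  have key := hC (fun u => hf.mk f u ^ p₁) (fun u => hg.mk g u ^ p₂)
    (fun x => hh.mk h x ^ Real.conjExponent q) (hf.measurable_mk.pow_const _)
    (hg.measurable_mk.pow_const _) (hh.measurable_mk.pow_const _)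
  simp only [cancel hp₁0, cancel hp₂0, cancel hconj] at key
  exact key
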